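/- Let $M$ be the rank one Heisenberg vertex operator algebra with modes $a(n)$, $[a(m),a(n)]=m\,\delta_{m,-n}$, realized on the Fock space spanned by the vectors $a(-n_1)\cdots a(-n_k)\mathbf 1$, $n_i\ge 1$. For $\alpha\in\mathbb C$ let $M\otimes e^{\alpha}$ be its irreducible module on which $a(0)$ acts by $\alpha$, and let $\mathcal M=\bigoplus_{\alpha\in\mathbb C}M\otimes e^{\alpha}$, with the grading operator $L(0)=\tfrac12 a(0)^2+\sum_{n>0}a(-n)a(n)$. Write $e^{\beta}$ for the highest weight vector $\mathbf 1\otimes e^{\beta}$ (so $L(0)e^\beta=\tfrac12\beta^2e^\beta$) and let $$\mathcal Y(e^{\beta},x)=e^{\beta\hat q}\,\exp\Big(\beta\sum_{n>0}\frac{a(-n)}{n}x^{n}\Big)\exp\Big(-\beta\sum_{n>0}\frac{a(n)}{n}x^{-n}\Big)x^{\beta a(0)}$$ be its intertwining vertex operator, a formal series in complex powers of $x$ with coefficients in $\mathrm{End}\,\mathcal M$, where $e^{\beta\hat q}(u\otimes e^{\gamma})=u\otimes e^{\gamma+\beta}$. Let $\tau\in\mathbb H$, and for $t\in\mathbb C$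 write $q^t=e^{2\pi i\tau t}$; for $q_i=e^{z_i}$ write $q_i^t=e^{tz_i}$. The torus intertwining $n$-point function on $M\otimes e^{\alpha}$ is $$Z^{(1)}_{\alpha}(e^{\beta_1},z_1;\dots;e^{\beta_n},z_n;q)=\mathrm{Tr}_{M\otimes e^{\alpha}}\Big(\mathcal Y(q_1^{L(0)}e^{\beta_1},q_1)\cdots\mathcal Y(q_n^{L(0)}e^{\beta_n},q_n)\,q^{L(0)-1/24}\Big),$$ that is, the sum over all $N\ge 0$ and all exponents $s_1,\dots,s_n\in\mathbb C$ of the trace, over the (finite-dimensional) $L(0)$-eigenspace of $M\otimes e^\alpha$ of eigenvalue $\tfrac12\alpha^2+N$, of the product of the coefficients of $x_i^{s_i}$ in $\mathcal Y(e^{\beta_i},x_i)$, $i=1,\dots,n$ in this order, times $\prod_i q_i^{\beta_i^2/2+s_i}\cdot q^{\alpha^2/2+N-1/24}$. Let $K(z,\tau)=\vartheta_1(z,\tau)/\partial_z\vartheta_1(0,\tau)$ be the genus one prime form, where $\vartheta_1(z,\tau)=\sum_{m\in\mathbb Z}e^{i\pi(m+\frac12)^2\tau+(m+\frac12)(z+i\pi)}$,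 and let $\eta$ be the Dedekind eta function. On the strip $0<\mathrm{Re}\,z<2\pi\,\mathrm{Im}\,\tau$, the function $K(\cdot,\tau)$ has a unique holomorphic logarithm $\ell$ with $\ell(z)-\mathrm{Log}\,z\to0$ as $z\to0$ in the strip, where $\mathrm{Log}$ is the principal logarithm; put $K(z,\tau)^{\chi}=e^{\chi\ell(z)}$ there. Then for all $n\ge0$, all $\alpha,\beta_1,\dots,\beta_n\in\mathbb C$ with $\sum_{i=1}^n\beta_i=0$, and all $z_1,\dots,z_n\in\mathbb C$ with $0<\mathrm{Re}(z_r-z_s)<2\pi\,\mathrm{Im}\,\tau$ for all $r<s$ (equivalently, if $n\ge2$, $|q_1|>\dots>|q_n|>|q\,q_1|$), the sum defining the $n$-point function converges absolutely and $$Z^{(1)}_{\alpha}(e^{\beta_1},z_1;\dots;e^{\beta_n},z_n;q)=\frac{q^{\alpha^2/2}}{\eta(\tau)}\,\exp\Big(\alpha\sum_{i=1}^n\beta_iz_i\Big)\prod_{1\le r<s\le n}K(z_r-z_s,\tau)^{\beta_r\beta_s}.$$ -/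

import Mathlib

open scoped BigOperators UpperHalfPlane Topology

noncomputable section

namespace HeisenbergTorus

/-! ### The Heisenberg Fock space -/

/-- The Fock space `M`: polynomials in `x₁, x₂, …`, where the monomial `x_{n₁} ⋯ x_{n_k}` is the
Fock vector `a(-n₁) ⋯ a(-n_k) 𝟏`. -/
abbrev Fock : Type := MvPolynomial ℕ+ ℂ

/-- The mode `a(-n)`, `n > 0`: multiplication by `x_n`. -/
def aNeg (n : ℕ+) : Module.End ℂ Fock :=
  LinearMap.mulLeft ℂ (MvPolynomial.X n)

/-- The mode `a(n)`, `n > 0`: the operator `n ∂/∂x_n`. -/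
def aPos (n : ℕ+) : Module.End ℂ Fock :=
  (n : ℂ) • (MvPolynomial.pderiv n).toLinearMap

/-- The Heisenberg relation `[a(m), a(-n)] = m δ_{m,n}`. -/
theorem aPos_comm_aNeg (m n : ℕ+) :
    aPos m * aNeg n - aNeg n * aPos m = if m = n then (m : ℂ) • 1 else 0 := by
  refine LinearMap.ext fun u => ?_
  by_cases h : m = n
  · subst h
    simp [aPos, aNeg, Derivation.leibniz, smul_add]
  · simp [aPos, aNeg, Derivation.leibniz, h, MvPolynomial.pderiv_X_of_ne (Ne.symm h)]

/-- The degree of Fock vectors: `x_n = a(-n) 𝟏` has degree `n`. -/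
def wt (n : ℕ+) : ℕ := n

/-! ### Locally finite sums of operators -/

/-- The sum of a family of operators only finitely many of which act non-trivially on any given
vector. -/
def locallyFiniteSum {ι V : Type*} [AddCommGroup V] [Module ℂ V] (A : ι → Module.End ℂ V)
    (hA : ∀ v, (Function.support fun i => A i v).Finite) : Module.End ℂ V where
  toFun v := ∑ᶠ i, A i v
  map_add' u v := by
    simp only [map_add]
    exact finsum_add_distrib (hA u) (hA v)
  map_smul' c v := by
    simp only [map_smul, RingHom.id_apply]
    exact (smul_finsum' c (hA v)).symm

/-- The vectors all of whose monomials have degree less than `m`. -/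
def degLT (m : ℕ) : Submodule ℂ Fock where
  carrier := {u | ∀ μ, MvPolynomial.coeff μ u ≠ 0 → Finsupp.weight wt μ < m}
  zero_mem' := fun μ h => absurd (MvPolynomial.coeff_zero μ) h
  add_mem' := by
    intro u v hu hv μ h
    by_cases h0 : MvPolynomial.coeff μ u = 0
    · exact hv μ (by simpa [h0] using h)
    · exact hu μ h0
  smul_mem' := by
    intro c u hu μ h
    exact hu μ (fun h0 => h (by simp [h0]))

theorem exists_mem_degLT (u : Fock) : ∃ m, u ∈ degLT m := by
  refine ⟨u.support.sup (Finsupp.weight wt) + 1, fun μ h => ?_⟩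
  have := Finset.le_sup (f := Finsupp.weight wt) (MvPolynomial.mem_support_iff.2 h)
  exact Nat.lt_succ_of_le this

theorem eq_zero_of_mem_degLT_zero {u : Fock} (h : u ∈ degLT 0) : u = 0 := by
  ext μ
  by_contra h0
  exact absurd (h μ (by simpa using h0)) (Nat.not_lt_zero _)

/-- `f` lowers degrees by at least `n`. -/
def Lowers (n : ℕ) (f : Module.End ℂ Fock) : Prop :=
  ∀ m, ∀ u ∈ degLT m, f u ∈ degLT (m - n)

theorem lowers_aPos (n : ℕ+) : Lowers n (aPos n) := by
  intro m u hu μ h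
  have h1 : MvPolynomial.coeff (μ + Finsupp.single n 1) u ≠ 0 := by
    intro h0
    apply h
    simp [aPos, MvPolynomial.coeff_pderiv, h0]
  have h2 := hu _ h1
  rw [map_add, Finsupp.weight_single] at h2
  simp only [wt, smul_eq_mul, one_mul] at h2
  omega

theorem Lowers.mul {n k : ℕ} {f g : Module.End ℂ Fock} (hf : Lowers n f) (hg : Lowers k g) :
    Lowers (n + k) (f * g) := by
  intro m u hu
  have := hf _ _ (hg m u hu)
  rwa [Nat.sub_sub, Nat.add_comm k n] at this

theorem Lowers.sum {ι : Type*} {n : ℕ} (s : Finset ι) (f : ι → Module.End ℂ Fock)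
    (hf : ∀ i ∈ s, Lowers n (f i)) : Lowers n (∑ i ∈ s, f i) := by
  intro m u hu
  rw [LinearMap.sum_apply]
  exact Submodule.sum_mem _ fun i hi => hf i hi m u hu

theorem Lowers.smul {n : ℕ} {f : Module.End ℂ Fock} (c : ℂ) (hf : Lowers n f) :
    Lowers n (c • f) :=
  fun m u hu => Submodule.smul_mem _ c (hf m u hu)

theorem lowers_zero (n : ℕ) : Lowers n 0 := fun _ _ _ => Submodule.zero_mem _

theorem finite_support_of_lowers {A : ℕ → Module.End ℂ Fock} (hA : ∀ l, Lowers l (A l))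
    (u : Fock) : (Function.support fun l => A l u).Finite := by
  obtain ⟨m, hm⟩ := exists_mem_degLT u
  refine (Set.finite_lt_nat m).subset fun l hl => ?_
  by_contra hlm
  have hle : m ≤ l := Nat.le_of_not_lt hlm
  refine hl (eq_zero_of_mem_degLT_zero ?_)
  have := hA l m u hm
  rwa [Nat.sub_eq_zero_of_le hle] at this

/-! ### Vertex operators of the highest weight vectors -/

/-- `exp (∑_{n > 0} A n xⁿ)` for operators `A n` on the Fock space, as a formal power series in `x`
with operator coefficients. As the exponent has no constant term, its powers beyond the `j`-th do
not contribute to the coefficient of `x^j`. -/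
def expSeries (A : ℕ+ → Module.End ℂ Fock) : PowerSeries (Module.End ℂ Fock) :=
  PowerSeries.mk fun j => ∑ m ∈ Finset.range (j + 1),
    ((m.factorial : ℂ)⁻¹) • PowerSeries.coeff j
      ((PowerSeries.mk fun i => if h : 0 < i then A (i.toPNat h) else 0) ^ m)

/-- `Y₋(β, x) = exp (β ∑_{n > 0} a(-n) xⁿ / n)`, a power series in `x`. -/
def Yminus (β : ℂ) : PowerSeries (Module.End ℂ Fock) :=
  expSeries fun n => (β / (n : ℂ)) • aNeg n

/-- `Y₊(β, x) = exp (- β ∑_{n > 0} a(n) x⁻ⁿ / n)`, a power series in `x⁻¹`. -/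
def Yplus (β : ℂ) : PowerSeries (Module.End ℂ Fock) :=
  expSeries fun n => (-β / (n : ℂ)) • aPos n

theorem lowers_coeff_Yplus (β : ℂ) (l : ℕ) : Lowers l (PowerSeries.coeff l (Yplus β)) := by
  have key : ∀ m j, Lowers j (PowerSeries.coeff j
      ((PowerSeries.mk fun i : ℕ => if h : 0 < i then (-β / ((i.toPNat h : ℕ) : ℂ)) •
        aPos (i.toPNat h) else 0) ^ m)) := by
    intro m
    induction m with
    | zero =>
      intro j
      rw [pow_zero, PowerSeries.coeff_one]
      split_ifs with h
      · subst h
        exact fun m u hu => hu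
      · exact lowers_zero j
    | succ m ih =>
      intro j
      rw [pow_succ, PowerSeries.coeff_mul]
      refine Lowers.sum _ _ fun p hp => ?_
      rw [← Finset.HasAntidiagonal.mem_antidiagonal.1 hp]
      refine (ih p.1).mul ?_
      rw [PowerSeries.coeff_mk]
      split_ifs with h
      · exact (lowers_aPos (p.2.toPNat h)).smul _
      · exact lowers_zero _
  rw [Yplus, expSeries, PowerSeries.coeff_mk]
  exact Lowers.sum _ _ fun m _ => (key m l).smul _

/-- The coefficient of `x^j` in a power series, for an integer `j`; zero for negative `j`. -/
def intCoeff (j : ℤ) (P : PowerSeries (Module.End ℂ Fock)) : Module.End ℂ Fock :=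
  if 0 ≤ j then PowerSeries.coeff j.toNat P else 0

/-- The coefficient of `x^k` in `Y₋(β, x) Y₊(β, x)`. -/
def oscMode (β : ℂ) (k : ℤ) : Module.End ℂ Fock :=
  locallyFiniteSum (fun l : ℕ => intCoeff (k + l) (Yminus β) * PowerSeries.coeff l (Yplus β))
    (fun u => (finite_support_of_lowers (lowers_coeff_Yplus β) u).subset fun l hl h0 =>
      hl (by
        have h0' : (PowerSeries.coeff l (Yplus β)) u = 0 := h0
        simp [h0']))

/-- The space `𝓜 = ⨁_{γ ∈ ℂ} M ⊗ e^γ`; `Finsupp.single γ u` is the vector `u ⊗ e^γ`. -/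
abbrev GenFock : Type := ℂ →₀ Fock

/-- The highest weight vector `e^β = 𝟏 ⊗ e^β`. -/
def hwVector (β : ℂ) : GenFock := Finsupp.single β 1

/-- The coefficient of `x^s`, `s ∈ ℂ`, in the intertwining vertex operator
`𝒴(e^β, x) = e^{β q̂} Y₋(β, x) Y₊(β, x) x^{β a(0)}`, a formal series in complex powers of `x` with
coefficients in `End 𝓜`. On `M ⊗ e^γ`, `x^{β a(0)}` is `x^{βγ}`, so only the powers `x^{βγ + k}` with
`k ∈ ℤ` occur, and `e^{β q̂}` maps `M ⊗ e^γ` to `M ⊗ e^{γ + β}`. -/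
def vertexCoeff (β s : ℂ) : Module.End ℂ GenFock :=
  Finsupp.lsum ℂ fun γ : ℂ =>
    Function.extend (fun k : ℤ => β * γ + (k : ℂ))
      (fun k : ℤ => (Finsupp.lsingle (γ + β) : Fock →ₗ[ℂ] GenFock) ∘ₗ oscMode β k) 0 s

/-! ### The Virasoro operator `L(0)` -/

theorem finite_support_aPos (u : Fock) :
    (Function.support fun n : ℕ+ => (aNeg n * aPos n) u).Finite := by
  obtain ⟨m, hm⟩ := exists_mem_degLT u
  refine ((Set.finite_lt_nat m).preimage (PNat.coe_injective.injOn)).subset fun n hn => ?_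
  by_contra hnm
  have hle : m ≤ (n : ℕ) := Nat.le_of_not_lt hnm
  refine hn ?_
  have h := lowers_aPos n m u hm
  rw [Nat.sub_eq_zero_of_le hle] at h
  simp [eq_zero_of_mem_degLT_zero h]

/-- `L(0) = a(0)² / 2 + ∑_{n > 0} a(-n) a(n)` on `𝓜`, the zero mode of the conformal vector
`a(-1)² 𝟏 / 2`; here `a(0) = γ` on `M ⊗ e^γ`. -/
def virasoroL0 : Module.End ℂ GenFock :=
  Finsupp.lsum ℂ fun γ : ℂ => (Finsupp.lsingle γ : Fock →ₗ[ℂ] GenFock) ∘ₗ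
    ((γ ^ 2 / 2) • 1 + locallyFiniteSum (fun n : ℕ+ => aNeg n * aPos n) finite_support_aPos)

/-- The `L(0)`-eigenspace of `M ⊗ e^α` for the eigenvalue `α² / 2 + N`: it consists of the vectors
`u ⊗ e^α` with `u` in `level N`. -/
def level (N : ℕ) : Submodule ℂ Fock := MvPolynomial.weightedHomogeneousSubmodule ℂ wt N

theorem aNeg_aPos_monomial (n : ℕ+) (μ : ℕ+ →₀ ℕ) (c : ℂ) :
    (aNeg n * aPos n) (MvPolynomial.monomial μ c) =
      ((n : ℂ) * (μ n : ℂ)) • MvPolynomial.monomial μ c := by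
  by_cases h : μ n = 0
  · simp [aNeg, aPos, MvPolynomial.pderiv_monomial, h]
  · have hle : Finsupp.single n 1 ≤ μ := by
      rw [Finsupp.single_le_iff]
      omega
    simp only [aNeg, aPos, Module.End.mul_apply, LinearMap.smul_apply,
      Derivation.coeFn_coe, MvPolynomial.pderiv_monomial, LinearMap.mulLeft_apply,
      MvPolynomial.X, MvPolynomial.smul_monomial, MvPolynomial.monomial_mul, smul_eq_mul]
    rw [add_tsub_cancel_of_le hle]
    congr 1
    ring

/-- Fock vectors are eigenvectors of `L(0)`. -/
theorem virasoroL0_monomial (γ : ℂ) (μ : ℕ+ →₀ ℕ) (c : ℂ) :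
    virasoroL0 (Finsupp.single γ (MvPolynomial.monomial μ c)) =
      (γ ^ 2 / 2 + (Finsupp.weight wt μ : ℂ)) •
        Finsupp.single γ (MvPolynomial.monomial μ c) := by
  have h : (∑ᶠ n : ℕ+, (aNeg n * aPos n) (MvPolynomial.monomial μ c)) =
      (Finsupp.weight wt μ : ℂ) • MvPolynomial.monomial μ c := by
    simp_rw [aNeg_aPos_monomial]
    rw [finsum_eq_sum_of_support_subset (s := μ.support)]
    · rw [← Finset.sum_smul]
      congr 1
      rw [Finsupp.weight_apply, Finsupp.sum]
      push_cast
      exact Finset.sum_congr rfl fun n _ => by simp [wt, mul_comm]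
    · intro n hn
      simp only [Finset.mem_coe, Finsupp.mem_support_iff]
      intro h0
      exact hn (by simp [h0])
  rw [virasoroL0, Finsupp.lsum_single, LinearMap.comp_apply, LinearMap.add_apply]
  change Finsupp.lsingle γ (((γ ^ 2 / 2) • (1 : Module.End ℂ Fock)) _ + ∑ᶠ n : ℕ+, _) = _
  rw [h, LinearMap.smul_apply, Module.End.one_apply, ← add_smul, map_smul]
  rfl

/-- `L(0)` is multiplication by `α² / 2 + N` on the vectors `u ⊗ e^α` with `u` in `level N`. -/
theorem virasoroL0_level (α : ℂ) (N : ℕ) (u : Fock) (hu : u ∈ level N) :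
    virasoroL0 (Finsupp.single α u) = (α ^ 2 / 2 + (N : ℂ)) • Finsupp.single α u := by
  rw [← MvPolynomial.support_sum_monomial_coeff u, ← Finsupp.lsingle_apply (R := ℂ), map_sum,
    map_sum, Finset.smul_sum]
  refine Finset.sum_congr rfl fun μ hμ => ?_
  rw [Finsupp.lsingle_apply, virasoroL0_monomial]
  have : Finsupp.weight wt μ = N := hu (MvPolynomial.mem_support_iff.1 hμ)
  rw [this]

/-- `L(0) e^β = (β² / 2) e^β`. -/
theorem virasoroL0_hwVector (β : ℂ) : virasoroL0 (hwVector β) = (β ^ 2 / 2) • hwVector β := by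
  have := virasoroL0_monomial β 0 1
  simpa [hwVector] using this

/-! ### The torus intertwining `n`-point function -/

/-- The projection of `𝓜` onto the `L(0)`-eigenspace of `M ⊗ e^α` of level `N`. -/
def levelProj (α : ℂ) (N : ℕ) : GenFock →ₗ[ℂ] level N :=
  ((MvPolynomial.weightedHomogeneousComponent wt N).codRestrict (level N)
    fun u => MvPolynomial.weightedHomogeneousComponent_mem wt u N) ∘ₗ Finsupp.lapply α

/-- The trace of the operator `A` over the (finite-dimensional) `L(0)`-eigenspace of `M ⊗ e^α` of
level `N`. -/
def levelTrace (α : ℂ) (N : ℕ) (A : Module.End ℂ GenFock) : ℂ :=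
  LinearMap.trace ℂ (level N)
    (levelProj α N ∘ₗ A ∘ₗ (Finsupp.lsingle α : Fock →ₗ[ℂ] GenFock) ∘ₗ (level N).subtype)

/-- The terms of the expansion of
`Tr_{M ⊗ e^α} (𝒴(q₁^{L(0)} e^{β₁}, q₁) ⋯ 𝒴(qₙ^{L(0)} e^{βₙ}, qₙ) q^{L(0) - 1/24})`
at `q_i = e^{z_i}`, `q = e^{2πiτ}`: the term with index `(N, s)` is the one of `L(0)`-weight `α² / 2 + N`
in the trace and of power `x_i^{s_i}` in the `i`-th vertex operator. Complex powers are
`q_i^t = e^{t z_i}` and `q^t = e^{2πiτt}`, and `q_i^{L(0)} e^{β_i} = q_i^{β_i²/2} e^{β_i}`. -/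
def nPointTerm {n : ℕ} (τ : ℍ) (α : ℂ) (β z : Fin n → ℂ) (p : ℕ × (Fin n → ℂ)) : ℂ :=
  levelTrace α p.1 (List.ofFn fun i => vertexCoeff (β i) (p.2 i)).prod *
    (∏ i, Complex.exp (β i ^ 2 / 2 * z i) * Complex.exp (p.2 i * z i)) *
    Complex.exp (2 * Real.pi * Complex.I * (τ : ℂ) * (α ^ 2 / 2 + (p.1 : ℂ) - 1 / 24))

/-- The torus intertwining `n`-point function
`Z_α(e^{β₁}, z₁; …; e^{βₙ}, zₙ; q)` on `M ⊗ e^α`. -/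
def nPoint {n : ℕ} (τ : ℍ) (α : ℂ) (β z : Fin n → ℂ) : ℂ :=
  ∑' p : ℕ × (Fin n → ℂ), nPointTerm τ α β z p

/-! ### The prime form -/

/-- The genus one theta series with real characteristics `a`, `b`. -/
def theta (a b : ℝ) (z τ : ℂ) : ℂ :=
  ∑' m : ℤ, Complex.exp (Complex.I * Real.pi * ((m : ℂ) + a) ^ 2 * τ +
    ((m : ℂ) + a) * (z + 2 * Real.pi * Complex.I * b))

/-- `ϑ₁`, the theta series with characteristics `1/2`, `1/2`. -/
def theta1 (z τ : ℂ) : ℂ := theta (1 / 2) (1 / 2) z τ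

/-- The genus one prime form `K(z, τ) = ϑ₁(z, τ) / ∂_z ϑ₁(0, τ)`. -/
def primeForm (z τ : ℂ) : ℂ := theta1 z τ / deriv (fun w => theta1 w τ) 0

/-- The strip `0 < Re z < 2π Im τ`, i.e. `|q| < |e^{-z}| < 1`. -/
def strip (τ : ℍ) : Set ℂ := {z | 0 < z.re ∧ z.re < 2 * Real.pi * τ.im}

/-- `ℓ` is, on the strip, the holomorphic branch of `log K(z, τ)` with `ℓ(z) = Log z + o(1)` for
`z → 0`, so that `exp (χ ℓ(z))` is the power `K(z, τ)^χ = z^χ (K(z, τ) / z)^χ` in which `z^χ` is the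
principal power and `(K(z, τ) / z)^χ` is continued from the value `1` at `z = 0`. As the strip is
connected, these conditions determine `ℓ` on it. -/
structure IsLogPrimeForm (τ : ℍ) (ℓ : ℂ → ℂ) : Prop where
  holo : DifferentiableOn ℂ ℓ (strip τ)
  exp_eq : ∀ z ∈ strip τ, Complex.exp (ℓ z) = primeForm z τ
  tendsto_zero : Filter.Tendsto (fun z => ℓ z - Complex.log z) (𝓝[strip τ] 0) (𝓝 0)

end HeisenbergTorus

end

/-!
The operators `𝒴(e^β, x)` are products of exponentials of creation and annihilation operators, so in
the monomial basis `x^μ` of the Fock space the trace is a sum of explicit terms: a term is given by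
the starting exponent `μ` and, for each of the `n` operators, by a pair `(λᵢ, ρᵢ)` of finitely
supported exponents, the parts of the creation and of the annihilation exponential that act
(`traceTerm`). Each coefficient of the `n`-point function is the sum of the terms of given degree
and given exponents (`nPointTerm_eq_tsum`); it therefore suffices to sum all the terms absolutely,
which `hasSum_traceTerm` does.

A term is a product over the modes `m > 0` of terms of the same kind in a single variable
(`traceTerm_eq_prod`). By the infinite distributive law `hasSum_finsupp_prod` the full sum is the
product over `m` of the traces for a single mode. In such a trace, `exp (b ∂)` is the translation by
`b`, which puts the operators in normal order at the cost of the factors `exp (bᵢ aⱼ)`, `i < j`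
(`hasSum_pathWt`); the diagonal coefficients of the normal ordered operator are Laguerre
polynomials, and their generating function (`hasSum_laguerre`) evaluates the trace
(`hasSum_modeTerm`). The absolute values of all the terms are again terms of this form, with the
parameters replaced by their absolute values, so that the same formulas yield absolute convergence.

The product over the modes of the single-mode traces is an exponential of sums
`∑ₘ qᵐ / (1 - qᵐ) xᵐ / m`, here called `lambertLog`, and these are the logarithms of the products
`∏ₖ (1 - qᵏ x)⁻¹` (`hasProd_one_sub`). On the other side, the Jacobi triple product
(`tsum_eq_triple_product`), obtained as a limit of its finite form, gives
`K(z, τ) = (e^{z/2} - e^{-z/2}) ∏ₖ (1 - qᵏ eᶻ) (1 - qᵏ e⁻ᶻ) / (1 - qᵏ)²` (`primeForm_eq`), whose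
logarithm on the strip is explicit (`logPrimeForm`). The two sides are matched by means of
`∑ βᵢ = 0`, which turns the diagonal terms `∑ βᵢ²` into `-2 ∑_{i < j} βᵢ βⱼ`
(`oscillator_exponent`) and the powers of the `qᵢ` into half-differences of the `zᵢ`
(`sum_zero_mode`).
-/

noncomputable section

namespace HeisenbergTorus

/-! ### Absolutely convergent double and power series -/

/-- Fubini for a complex family whose iterated sums converge absolutely; absolute convergence is
phrased through the complex-valued family of norms so that one formula can serve for both the
family and its norms. -/
theorem hasSum_prod_of_iterated {α β : Type*} {f : α × β → ℂ} {g g' : α → ℂ} {S : ℂ}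
    (hf : ∀ a, HasSum (fun b => f (a, b)) (g a)) (hg : HasSum g S)
    (hf' : ∀ a, HasSum (fun b => ((‖f (a, b)‖ : ℝ) : ℂ)) (g' a)) (hg' : Summable g') :
    HasSum f S := by
  have hs : ∀ a, Summable fun b => ‖f (a, b)‖ := fun a =>
    Complex.summable_ofReal.1 (hf' a).summable
  have hn : Summable fun p => ‖f p‖ := by
    refine (summable_prod_of_nonneg fun _ => norm_nonneg _).2 ⟨hs, ?_⟩
    refine Complex.summable_ofReal.1 (hg'.congr fun a => ?_)
    rw [Complex.ofReal_tsum]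
    exact (hf' a).tsum_eq.symm
  have h := hn.of_norm.hasSum
  rwa [(h.prod_fiberwise hf).unique hg] at h

/-- Equal sums of everywhere convergent families of monomials have equal coefficients. -/
theorem tsum_coeff_eq_of_hasSum {ι κ : Type} {f : ι → ℂ} {e : ι → ℕ} {g : κ → ℂ} {d : κ → ℕ}
    {G : ℂ → ℂ} (hf : ∀ x, HasSum (fun i => f i * x ^ e i) (G x))
    (hg : ∀ x, HasSum (fun k => g k * x ^ d k) (G x)) (N : ℕ) :
    ∑' i : e ⁻¹' {N}, f i = ∑' k : d ⁻¹' {N}, g k := by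
  have key : ∀ {ι : Type} {f : ι → ℂ} {e : ι → ℕ},
      (∀ x, HasSum (fun i => f i * x ^ e i) (G x)) →
      HasFPowerSeriesAt G
        (FormalMultilinearSeries.ofScalars ℂ fun N => ∑' i : e ⁻¹' {N}, f i) 0 := by
    intro ι f e hf
    refine hasFPowerSeriesAt_iff.2 (Filter.Eventually.of_forall fun x => ?_)
    rw [zero_add]
    convert! (hf x).tsum_fiberwise e using 2 with N
    rw [FormalMultilinearSeries.coeff_ofScalars, smul_eq_mul, ← tsum_mul_left]
    refine tsum_congr fun i => ?_
    rw [show e i = N from i.2, mul_comm]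
  have h := congrArg (fun p => FormalMultilinearSeries.coeff p N)
    ((key hf).eq_formalMultilinearSeries (key hg))
  simpa [FormalMultilinearSeries.coeff_ofScalars] using h

/-! ### Normal ordering for a single mode -/

/-- The exponent reached from `μ` by the operators `x^{λ₁} ∂^{ρ₁} ⋯ x^{λₙ} ∂^{ρₙ}` (up to scalars),
the last one acting first; `s i = (λᵢ, ρᵢ)`. The exponents are natural numbers for one variable and
finitely supported functions for infinitely many. The subtraction is truncated; this is harmless, as
the coefficient `pathWt` vanishes where truncation occurs. -/
def pathEnd {E : Type*} [Add E] [Sub E] : {n : ℕ} → (Fin n → E × E) → E → E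
  | 0, _, μ => μ
  | _ + 1, s, μ => pathEnd (Fin.tail s) μ - (s 0).2 + (s 0).1

/-- The coefficient of `x^{ν - ρ + λ}` in the `(λ, ρ)`-term of `exp (a x) exp (b ∂)` applied to
`x^ν`, for `p = (λ, ρ)`. -/
def stepWt (a b : ℂ) (p : ℕ × ℕ) (ν : ℕ) : ℂ :=
  a ^ p.1 / (p.1.factorial : ℂ) * (b ^ p.2 * (ν.choose p.2 : ℂ))

/-- The coefficient of `x^{pathEnd s μ}` in the `s`-term of
`exp (A₁ x) exp (B₁ ∂) ⋯ exp (Aₙ x) exp (Bₙ ∂)` applied to `x^μ`. -/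
def pathWt : {n : ℕ} → (A B : Fin n → ℂ) → (Fin n → ℕ × ℕ) → ℕ → ℂ
  | 0, _, _, _, _ => 1
  | _ + 1, A, B, s, μ => pathWt (Fin.tail A) (Fin.tail B) (Fin.tail s) μ *
      stepWt (A 0) (B 0) (s 0) (pathEnd (Fin.tail s) μ)

theorem norm_stepWt (a b : ℂ) (p : ℕ × ℕ) (ν : ℕ) :
    ((‖stepWt a b p ν‖ : ℝ) : ℂ) = stepWt (‖a‖ : ℝ) (‖b‖ : ℝ) p ν := by
  simp [stepWt]

theorem norm_pathWt {n : ℕ} (A B : Fin n → ℂ) (s : Fin n → ℕ × ℕ) (μ : ℕ) :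
    ((‖pathWt A B s μ‖ : ℝ) : ℂ) =
      pathWt (fun i => ((‖A i‖ : ℝ) : ℂ)) (fun i => ((‖B i‖ : ℝ) : ℂ)) s μ := by
  induction n with
  | zero => simp [pathWt]
  | succ n ih =>
    rw [pathWt, norm_mul, Complex.ofReal_mul, ih, norm_stepWt, pathWt]
    rfl

theorem hasSum_pow_div_factorial (z : ℂ) :
    HasSum (fun k : ℕ => z ^ k / (k.factorial : ℂ)) (Complex.exp z) := by
  have h := NormedSpace.expSeries_div_hasSum_exp z
  rwa [← Complex.exp_eq_exp_ℂ] at h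

theorem hasSum_binomial (b x : ℂ) (ν : ℕ) :
    HasSum (fun k : ℕ => b ^ k * (ν.choose k : ℂ) * x ^ (ν - k)) ((x + b) ^ ν) := by
  rw [add_comm x b, add_pow]
  have h := hasSum_sum_of_ne_finset_zero (L := SummationFilter.unconditional ℕ)
    (f := fun k : ℕ => b ^ k * (ν.choose k : ℂ) * x ^ (ν - k)) (s := Finset.range (ν + 1))
    (fun k hk => by
      rw [Nat.choose_eq_zero_of_lt (by simpa [Nat.lt_succ_iff] using hk)]
      simp)
  convert! h using 1
  exact Finset.sum_congr rfl fun k _ => by ring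

theorem hasSum_stepWt (a b x : ℂ) (ν : ℕ) :
    HasSum (fun p : ℕ × ℕ => stepWt a b p ν * x ^ (ν - p.2 + p.1))
      (Complex.exp (a * x) * (x + b) ^ ν) := by
  have h1 := hasSum_pow_div_factorial (a * x)
  have h2 := hasSum_binomial b x ν
  have hs := summable_mul_of_summable_norm h1.summable.norm h2.summable.norm
  have h3 := h1.mul h2 hs
  have h4 : (fun p : ℕ × ℕ => stepWt a b p ν * x ^ (ν - p.2 + p.1)) = fun p : ℕ × ℕ =>
      (a * x) ^ p.1 / (p.1.factorial : ℂ) * (b ^ p.2 * (ν.choose p.2 : ℂ) * x ^ (ν - p.2)) := by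
    ext p
    rw [stepWt, pow_add, mul_pow]
    ring
  rw [h4]
  exact h3

theorem sum_filter_lt_succ {n : ℕ} (A B : Fin (n + 1) → ℂ) :
    ∑ p : Fin (n + 1) × Fin (n + 1) with p.1 < p.2, B p.1 * A p.2 =
      B 0 * ∑ i, Fin.tail A i +
        ∑ p : Fin n × Fin n with p.1 < p.2, Fin.tail B p.1 * Fin.tail A p.2 := by
  simp only [Finset.sum_filter, Fintype.sum_prod_type, Fin.sum_univ_succ, Finset.mul_sum,
    Fin.succ_pos, Fin.not_lt_zero, Fin.succ_lt_succ_iff, if_true, if_false, zero_add, Fin.tail]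

/-- Moving all `exp (Bᵢ ∂)` to the right of all `exp (Aⱼ x)` produces the factor
`∏_{i < j} exp (Bᵢ Aⱼ)`, since `exp (b ∂)` is the translation by `b`. -/
theorem hasSum_pathWt {n : ℕ} (A B : Fin n → ℂ) (x : ℂ) (μ : ℕ) :
    HasSum (fun s => pathWt A B s μ * x ^ pathEnd s μ)
      (Complex.exp (∑ p : Fin n × Fin n with p.1 < p.2, B p.1 * A p.2) *
        (Complex.exp ((∑ i, A i) * x) * (x + ∑ i, B i) ^ μ)) := by
  induction n generalizing x with
  | zero => simp [pathWt, pathEnd]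
  | succ n ih =>
    let e : (Fin n → ℕ × ℕ) × (ℕ × ℕ) ≃ (Fin (n + 1) → ℕ × ℕ) :=
      (Equiv.prodComm _ _).trans (Fin.consEquiv fun _ => ℕ × ℕ)
    have split : ∀ (A B : Fin (n + 1) → ℂ) (x : ℂ) (s : Fin n → ℕ × ℕ) (p : ℕ × ℕ),
        pathWt A B (e (s, p)) μ * x ^ pathEnd (e (s, p)) μ =
          pathWt (Fin.tail A) (Fin.tail B) s μ *
            (stepWt (A 0) (B 0) p (pathEnd s μ) * x ^ (pathEnd s μ - p.2 + p.1)) := by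
      intro A B x s p
      have he : e (s, p) = Fin.cons p s := rfl
      simp only [pathWt, pathEnd, he, Fin.tail_cons, Fin.cons_zero, mul_assoc]
    have inner : ∀ (A B : Fin (n + 1) → ℂ) (x : ℂ) (s : Fin n → ℕ × ℕ),
        HasSum (fun p => pathWt A B (e (s, p)) μ * x ^ pathEnd (e (s, p)) μ)
          (pathWt (Fin.tail A) (Fin.tail B) s μ *
            (Complex.exp (A 0 * x) * (x + B 0) ^ pathEnd s μ)) := by
      intro A B x s
      simp only [split]
      exact (hasSum_stepWt _ _ _ _).mul_left _
    have outer : ∀ (A B : Fin (n + 1) → ℂ) (x : ℂ), HasSum (fun s =>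
        pathWt (Fin.tail A) (Fin.tail B) s μ *
            (Complex.exp (A 0 * x) * (x + B 0) ^ pathEnd s μ)) _ := fun A B x => by
      have := (ih (Fin.tail A) (Fin.tail B) (x + B 0)).mul_left (Complex.exp (A 0 * x))
      simpa only [mul_left_comm] using this
    rw [← e.hasSum_iff]
    refine hasSum_prod_of_iterated (inner A B x) ?_
      (g' := fun s => pathWt (Fin.tail fun i => ((‖A i‖ : ℝ) : ℂ))
        (Fin.tail fun i => ((‖B i‖ : ℝ) : ℂ)) s μ * (Complex.exp ((‖A 0‖ : ℝ) * (‖x‖ : ℝ)) *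
          (((‖x‖ : ℝ) : ℂ) + ((‖B 0‖ : ℝ) : ℂ)) ^ pathEnd s μ)) (fun s => ?_) (outer _ _ _).summable
    · convert! outer A B x using 1
      rw [sum_filter_lt_succ, mul_comm (B 0), Fin.sum_univ_succ, Fin.sum_univ_succ, add_mul,
        mul_add, Complex.exp_add, Complex.exp_add, Complex.exp_add, add_assoc]
      simp only [Fin.tail]
      ring
    · have h := inner (fun i => ((‖A i‖ : ℝ) : ℂ)) (fun i => ((‖B i‖ : ℝ) : ℂ)) ((‖x‖ : ℝ) : ℂ) s
      convert! h using 2 with p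
      rw [Function.comp_apply, norm_mul, Complex.ofReal_mul, norm_pathWt, norm_pow,
        Complex.ofReal_pow]

/-! ### The trace over a single mode -/

/-- The diagonal matrix coefficient at `x^μ` of
`exp (A₁ x) exp (B₁ ∂) ⋯ exp (Aₙ x) exp (Bₙ ∂)`, a Laguerre polynomial up to a scalar. -/
theorem hasSum_diag {n : ℕ} (A B : Fin n → ℂ) (μ : ℕ) :
    HasSum (fun s => if pathEnd s μ = μ then pathWt A B s μ else 0)
      (Complex.exp (∑ p : Fin n × Fin n with p.1 < p.2, B p.1 * A p.2) *
        ∑' k : ℕ, ((∑ i, A i) * ∑ i, B i) ^ k / (k.factorial : ℂ) * (μ.choose k : ℂ)) := by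
  set c := Complex.exp (∑ p : Fin n × Fin n with p.1 < p.2, B p.1 * A p.2)
  have hs : Summable fun s => pathWt A B s μ := by simpa using (hasSum_pathWt A B 1 μ).summable
  have h1 := tsum_coeff_eq_of_hasSum (fun x => hasSum_pathWt A B x μ)
    (g := fun p : ℕ × ℕ => c * stepWt (∑ i, A i) (∑ i, B i) p μ)
    (fun x => by
      simpa only [mul_assoc] using (hasSum_stepWt (∑ i, A i) (∑ i, B i) x μ).mul_left c) μ
  have h2 := (hs.indicator ((fun s => pathEnd s μ) ⁻¹' {μ})).hasSum
  rw [← tsum_subtype _ (fun s => pathWt A B s μ), h1,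
    tsum_subtype _ (fun p : ℕ × ℕ => c * stepWt (∑ i, A i) (∑ i, B i) p μ)] at h2
  have h3 : (∑' k : ℕ, c * (((∑ i, A i) * ∑ i, B i) ^ k / (k.factorial : ℂ) *
      (μ.choose k : ℂ))) = ∑' p : ℕ × ℕ, ((fun p : ℕ × ℕ => μ - p.2 + p.1) ⁻¹' {μ}).indicator
        (fun p => c * stepWt (∑ i, A i) (∑ i, B i) p μ) p := by
    have hinj : Function.Injective fun k : ℕ => (k, k) := fun a b h => congrArg Prod.fst h
    rw [← hinj.tsum_eq]
    · refine tsum_congr fun k => ?_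
      by_cases hk : k ≤ μ
      · rw [Set.indicator_of_mem (by simp; omega), stepWt, mul_pow]
        ring
      · have h0 := Nat.choose_eq_zero_of_lt (show μ < k by omega)
        rw [h0, Set.indicator_apply_eq_zero.2 fun _ => by simp [stepWt, h0]]
        simp
    · intro p hp
      have hp' := Set.indicator_apply_ne_zero.1 hp
      have h5 : μ - p.2 + p.1 = μ := hp'.1
      have h6 : p.2 ≤ μ := by
        by_contra h
        refine hp'.2 ?_
        simp [stepWt, Nat.choose_eq_zero_of_lt (show μ < p.2 by omega)]
      exact ⟨p.1, Prod.ext rfl (by simp; omega)⟩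
  rw [← tsum_mul_left, h3]
  convert! h2 using 2 with s
  classical
  simp [Set.indicator_apply]

theorem hasSum_choose_mul_pow {Q : ℂ} (hQ : ‖Q‖ < 1) (k : ℕ) :
    HasSum (fun μ : ℕ => (μ.choose k : ℂ) * Q ^ μ) (Q ^ k / (1 - Q) ^ (k + 1)) := by
  have h := (hasSum_choose_mul_geometric_of_norm_lt_one k hQ).mul_left (Q ^ k)
  rw [← Function.Injective.hasSum_iff (add_left_injective k)]
  · convert! h using 1
    · ext μ
      simp only [Function.comp_apply, pow_add]
      ring
    · ring
  · intro μ hμ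
    have : μ < k := by
      by_contra h
      exact hμ ⟨μ - k, by simp; omega⟩
    simp [Nat.choose_eq_zero_of_lt this]

/-- The generating function of the Laguerre polynomials. -/
theorem hasSum_laguerre {Q : ℂ} (hQ : ‖Q‖ < 1) (c : ℂ) :
    HasSum (fun μ : ℕ => Q ^ μ * ∑' k : ℕ, c ^ k / (k.factorial : ℂ) * (μ.choose k : ℂ))
      ((1 - Q)⁻¹ * Complex.exp (c * (Q / (1 - Q)))) := by
  have inner : ∀ (c Q : ℂ), ‖Q‖ < 1 → ∀ k : ℕ,
      HasSum (fun μ : ℕ => c ^ k / (k.factorial : ℂ) * ((μ.choose k : ℂ) * Q ^ μ))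
        ((1 - Q)⁻¹ * ((c * (Q / (1 - Q))) ^ k / (k.factorial : ℂ))) := by
    intro c Q hQ k
    convert! (hasSum_choose_mul_pow hQ k).mul_left (c ^ k / (k.factorial : ℂ)) using 1
    rw [mul_pow, div_pow, pow_succ]
    field_simp
  have outer : ∀ c Q : ℂ, HasSum (fun k : ℕ =>
      (1 - Q)⁻¹ * ((c * (Q / (1 - Q))) ^ k / (k.factorial : ℂ)))
        ((1 - Q)⁻¹ * Complex.exp (c * (Q / (1 - Q)))) := by
    exact fun c Q => (hasSum_pow_div_factorial _).mul_left _
  have h : HasSum (fun p : ℕ × ℕ => c ^ p.1 / (p.1.factorial : ℂ) *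
      ((p.2.choose p.1 : ℂ) * Q ^ p.2)) ((1 - Q)⁻¹ * Complex.exp (c * (Q / (1 - Q)))) := by
    refine hasSum_prod_of_iterated (inner c Q hQ) (outer c Q) (fun k => ?_)
      (outer (‖c‖ : ℝ) (‖Q‖ : ℝ)).summable
    convert! inner (‖c‖ : ℝ) (‖Q‖ : ℝ) (by simpa using hQ) k using 2 with μ
    simp
  have h' := (Equiv.prodComm ℕ ℕ).hasSum_iff.2 h
  convert! h'.prod_fiberwise fun μ => (h'.summable.prod_factor μ).hasSum using 1
  ext μ
  rw [← tsum_mul_left]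
  refine tsum_congr fun k => ?_
  simp only [Function.comp_apply, Equiv.prodComm_apply, Prod.swap_prod_mk]
  ring

/-- The `(μ, s)`-term of the trace of
`exp (A₁ x) exp (B₁ ∂) ⋯ exp (Aₙ x) exp (Bₙ ∂) Q^{x ∂}` over polynomials in `x`. -/
def modeTerm {n : ℕ} (Q : ℂ) (A B : Fin n → ℂ) (t : ℕ × (Fin n → ℕ × ℕ)) : ℂ :=
  Q ^ t.1 * if pathEnd t.2 t.1 = t.1 then pathWt A B t.2 t.1 else 0

/-- The value of the trace of
`exp (A₁ x) exp (B₁ ∂) ⋯ exp (Aₙ x) exp (Bₙ ∂) Q^{x ∂}` over polynomials in `x`. -/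
def modeTrace {n : ℕ} (Q : ℂ) (A B : Fin n → ℂ) : ℂ :=
  (1 - Q)⁻¹ * Complex.exp ((∑ p : Fin n × Fin n with p.1 < p.2, B p.1 * A p.2) +
    (∑ i, A i) * (∑ i, B i) * (Q / (1 - Q)))

theorem norm_modeTerm {n : ℕ} (Q : ℂ) (A B : Fin n → ℂ) (t : ℕ × (Fin n → ℕ × ℕ)) :
    ((‖modeTerm Q A B t‖ : ℝ) : ℂ) =
      modeTerm (‖Q‖ : ℝ) (fun i => ((‖A i‖ : ℝ) : ℂ)) (fun i => ((‖B i‖ : ℝ) : ℂ)) t := by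
  rw [modeTerm, norm_mul, Complex.ofReal_mul, norm_pow, Complex.ofReal_pow, modeTerm]
  split_ifs
  · rw [norm_pathWt]
  · simp

theorem hasSum_modeTerm {n : ℕ} {Q : ℂ} (hQ : ‖Q‖ < 1) (A B : Fin n → ℂ) :
    HasSum (modeTerm Q A B) (modeTrace Q A B) := by
  have inner : ∀ (Q : ℂ) (A B : Fin n → ℂ) (μ : ℕ),
      HasSum (fun s => modeTerm Q A B (μ, s)) _ := fun Q A B μ =>
    (hasSum_diag A B μ).mul_left (Q ^ μ)
  have outer : ∀ (Q : ℂ) (A B : Fin n → ℂ), ‖Q‖ < 1 → HasSum (fun μ : ℕ => Q ^ μ *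
      (Complex.exp (∑ p : Fin n × Fin n with p.1 < p.2, B p.1 * A p.2) *
        ∑' k : ℕ, ((∑ i, A i) * ∑ i, B i) ^ k / (k.factorial : ℂ) * (μ.choose k : ℂ)))
      (modeTrace Q A B) := by
    intro Q A B hQ
    have h := (hasSum_laguerre hQ ((∑ i, A i) * ∑ i, B i)).mul_left
      (Complex.exp (∑ p : Fin n × Fin n with p.1 < p.2, B p.1 * A p.2))
    rw [modeTrace, Complex.exp_add]
    simpa only [mul_left_comm] using h
  refine hasSum_prod_of_iterated (inner Q A B) (outer Q A B hQ) (fun μ => ?_)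
    (outer (‖Q‖ : ℝ) (fun i => ((‖A i‖ : ℝ) : ℂ)) (fun i => ((‖B i‖ : ℝ) : ℂ))
      (by simpa using hQ)).summable
  simpa only [norm_modeTerm] using inner (‖Q‖ : ℝ) (fun i => ((‖A i‖ : ℝ) : ℂ))
    (fun i => ((‖B i‖ : ℝ) : ℂ)) μ

/-! ### Sums over finitely supported functions -/

/-- The distributive law for a finite product of absolutely convergent series, indexed by the
functions supported in a fixed finite set. -/
theorem hasSum_subtype_support_subset {ι X R : Type*} [Zero X] [NormedCommRing R]
    [CompleteSpace R] {f : ι → X → R} {F : ι → R} (hF : ∀ m, HasSum (f m) (F m))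
    (hn : ∀ m, Summable fun x => ‖f m x‖) (S : Finset ι) :
    HasSum (fun ξ : {ξ : ι →₀ X // ξ.support ⊆ S} => ∏ m ∈ S, f m (ξ.1 m)) (∏ m ∈ S, F m) ∧
      Summable fun ξ : {ξ : ι →₀ X // ξ.support ⊆ S} => ‖∏ m ∈ S, f m (ξ.1 m)‖ := by
  classical
  induction S using Finset.induction_on with
  | empty =>
    have : Unique {ξ : ι →₀ X // ξ.support ⊆ ∅} :=
      { default := ⟨0, by simp⟩
        uniq := fun ξ => Subtype.ext (by simpa using ξ.2) }
    refine ⟨?_, Summable.of_finite⟩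
    have h := hasSum_unique fun ξ : {ξ : ι →₀ X // ξ.support ⊆ ∅} =>
      ∏ m ∈ (∅ : Finset ι), f m (ξ.1 m)
    simpa only [Finset.prod_empty] using h
  | insert a S ha ih =>
    let e : X × {ξ : ι →₀ X // ξ.support ⊆ S} ≃ {ξ : ι →₀ X // ξ.support ⊆ insert a S} :=
      { toFun := fun p => ⟨p.2.1.update a p.1, fun m hm => by
          by_cases h : m = a
          · exact h ▸ Finset.mem_insert_self _ _
          · refine Finset.mem_insert_of_mem (p.2.2 ?_)
            simpa only [Finsupp.mem_support_iff, Finsupp.coe_update, Function.update_of_ne h]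
              using hm⟩
        invFun := fun ξ => (ξ.1 a, ⟨ξ.1.erase a, by
          rw [Finsupp.support_erase]
          exact Finset.subset_insert_iff.1 ξ.2⟩)
        left_inv := by
          rintro ⟨x, ξ⟩
          have hξ : ξ.1 a = 0 := by
            by_contra h
            exact ha (ξ.2 (Finsupp.mem_support_iff.2 h))
          refine Prod.ext (by simp) (Subtype.ext ?_)
          ext m
          by_cases hm : m = a
          · subst hm
            simp [hξ]
          · simp [Finsupp.erase_ne hm, Finsupp.update, hm]
        right_inv := by
          rintro ⟨ξ, hξ⟩
          refine Subtype.ext ?_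
          ext m
          by_cases hm : m = a
          · subst hm
            simp
          · simp [Finsupp.erase_ne hm, Finsupp.update, hm] }
    have split : ∀ p, ∏ m ∈ insert a S, f m ((e p).1 m) =
        f a p.1 * ∏ m ∈ S, f m (p.2.1 m) := by
      rintro ⟨x, ξ⟩
      rw [Finset.prod_insert ha]
      congr 1
      · simp [e]
      · refine Finset.prod_congr rfl fun m hm => ?_
        have : m ≠ a := fun h => ha (h ▸ hm)
        simp [e, Finsupp.update, this]
    have hsum := summable_mul_of_summable_norm (hn a) ih.2
    have hsum' := (hn a).mul_norm ih.2
    rw [← e.hasSum_iff, ← e.summable_iff, Finset.prod_insert ha]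
    constructor
    · convert! (hF a).mul ih.1 hsum using 1
      ext p
      exact split p
    · refine hsum'.congr fun p => ?_
      rw [Function.comp_apply, split]

/-- The infinite distributive law `∏ₘ ∑ₓ f m x = ∑_ξ ∏ₘ f m (ξ m)`, the sum extending over the
finitely supported `ξ`. -/
theorem hasSum_finsupp_prod {ι X : Type*} [Zero X] {f : ι → X → ℂ} (h0 : ∀ m, f m 0 = 1)
    {F : ι → ℂ} (hF : ∀ m, HasSum (f m) (F m)) (hs : Summable fun m => (∑' x, ‖f m x‖) - 1)
    {P : ℂ} (hP : HasProd F P) : HasSum (fun ξ : ι →₀ X => ξ.prod f) P := by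
  classical
  have hn : ∀ m, Summable fun x => ‖f m x‖ := fun m => (hF m).summable.norm
  have hone : ∀ m, 0 ≤ (∑' x, ‖f m x‖) - 1 := fun m => by
    have := (hn m).le_tsum 0 fun _ _ => norm_nonneg _
    rw [h0, norm_one] at this
    linarith
  have hprod : ∀ (S : Finset ι) (ξ : ι →₀ X), ξ.support ⊆ S → ξ.prod f = ∏ m ∈ S, f m (ξ m) :=
    fun S ξ h => Finsupp.prod_of_support_subset ξ h f fun m _ => h0 m
  have hsummable : Summable fun ξ : ι →₀ X => ‖ξ.prod f‖ := by
    refine summable_of_sum_le (c := Real.exp (∑' m, ((∑' x, ‖f m x‖) - 1)))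
      (fun _ => norm_nonneg _) fun U => ?_
    set S := U.sup Finsupp.support
    have hS := hasSum_subtype_support_subset (f := fun m x => ‖f m x‖)
      (fun m => (hn m).hasSum) (fun m => by simpa using hn m) S
    have hU : ∀ ξ ∈ U, ξ.support ⊆ S := fun ξ hξ => Finset.le_sup (f := Finsupp.support) hξ
    calc ∑ ξ ∈ U, ‖ξ.prod f‖
        = ∑ ξ ∈ U.subtype fun ξ => ξ.support ⊆ S, ∏ m ∈ S, ‖f m (ξ.1 m)‖ := by
          rw [← Finset.sum_subtype_of_mem (fun ξ => ‖ξ.prod f‖) hU]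
          exact Finset.sum_congr rfl fun ξ _ => by rw [hprod S ξ.1 ξ.2, norm_prod]
      _ ≤ ∏ m ∈ S, ∑' x, ‖f m x‖ :=
          sum_le_hasSum _ (fun ξ _ => Finset.prod_nonneg fun _ _ => norm_nonneg _) hS.1
      _ ≤ ∏ m ∈ S, Real.exp ((∑' x, ‖f m x‖) - 1) :=
          Finset.prod_le_prod (fun m _ => tsum_nonneg fun _ => norm_nonneg _) fun m _ => by
            have := Real.add_one_le_exp ((∑' x, ‖f m x‖) - 1)
            linarith
      _ = Real.exp (∑ m ∈ S, ((∑' x, ‖f m x‖) - 1)) := (Real.exp_sum _ _).symm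
      _ ≤ _ := Real.exp_le_exp.2 (hs.sum_le_tsum _ fun m _ => hone m)
  -- The partial products are the sums over the `ξ` supported in a finite set.
  have hpart : ∀ S : Finset ι,
      ∑' ξ : ι →₀ X, (if ξ.support ⊆ S then ξ.prod f else 0) = ∏ m ∈ S, F m := by
    intro S
    rw [← (hasSum_subtype_support_subset hF hn S).1.tsum_eq]
    have h := tsum_subtype {ξ : ι →₀ X | ξ.support ⊆ S} fun ξ => ξ.prod f
    simp only [Set.indicator_apply, Set.mem_ofPred_eq] at h
    rw [← h]
    exact tsum_congr fun ξ => hprod S ξ.1 ξ.2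
  have hlim := tendsto_tsum_of_dominated_convergence (𝓕 := Filter.atTop)
    (f := fun (S : Finset ι) (ξ : ι →₀ X) => if ξ.support ⊆ S then ξ.prod f else 0)
    (g := fun ξ => ξ.prod f) hsummable
    (fun ξ => tendsto_const_nhds.congr' (by
      filter_upwards [Filter.eventually_ge_atTop ξ.support] with S hS
      rw [if_pos hS]))
    (Filter.Eventually.of_forall fun S ξ => by split_ifs <;> simp)
  simp only [hpart] at hlim
  have hP' : Filter.Tendsto (fun S : Finset ι => ∏ m ∈ S, F m) Filter.atTop (𝓝 P) := by
    simpa [HasProd] using hP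
  rw [tendsto_nhds_unique hP' hlim]
  exact hsummable.of_norm.hasSum

/-! ### Exponentials of commuting modes -/

section ExpSeries

variable {R : Type*} [Ring R]

/-- The Euler operator `x d/dx` on power series with possibly noncommuting coefficients. -/
def eulerOp (f : PowerSeries R) : PowerSeries R :=
  PowerSeries.mk fun j => j • PowerSeries.coeff j f

theorem eulerOp_mul (f g : PowerSeries R) : eulerOp (f * g) = eulerOp f * g + f * eulerOp g := by
  ext j
  simp only [eulerOp, PowerSeries.coeff_mk, PowerSeries.coeff_mul, map_add, Finset.smul_sum,
    ← Finset.sum_add_distrib]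
  refine Finset.sum_congr rfl fun p hp => ?_
  rw [← Finset.HasAntidiagonal.mem_antidiagonal.1 hp, add_smul, smul_mul_assoc, mul_smul_comm]

theorem eulerOp_pow {f : PowerSeries R} (hf : Commute f (eulerOp f)) (m : ℕ) :
    eulerOp (f ^ (m + 1)) = (m + 1) • (eulerOp f * f ^ m) := by
  induction m with
  | zero => simp
  | succ m ih =>
    rw [pow_succ, eulerOp_mul, ih, (hf.pow_left (m + 1)).eq, smul_mul_assoc, mul_assoc,
      ← pow_succ, ← succ_nsmul]

theorem coeff_pow_eq_zero {f : PowerSeries R} (hf : PowerSeries.coeff 0 f = 0) {m j : ℕ}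
    (h : j < m) : PowerSeries.coeff j (f ^ m) = 0 := by
  induction m generalizing j with
  | zero => omega
  | succ m ih =>
    rw [pow_succ, PowerSeries.coeff_mul]
    refine Finset.sum_eq_zero fun p hp => ?_
    have hp' := Finset.HasAntidiagonal.mem_antidiagonal.1 hp
    by_cases h1 : p.1 < m
    · rw [ih h1, zero_mul]
    · rw [show p.2 = 0 by omega, hf, mul_zero]

end ExpSeries

/-- The differential equation `x E' = (∑ n A_n x^n) E` of the exponential series. -/
theorem smul_coeff_expSeries {A : ℕ+ → Module.End ℂ Fock} (hA : ∀ m n, Commute (A m) (A n))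
    (j : ℕ) : (j : ℂ) • PowerSeries.coeff j (expSeries A) =
      ∑ p ∈ Finset.HasAntidiagonal.antidiagonal j,
        (p.1 : ℂ) • ((if h : 0 < p.1 then A (p.1.toPNat h) else 0) *
          PowerSeries.coeff p.2 (expSeries A)) := by
  set P : PowerSeries (Module.End ℂ Fock) :=
    PowerSeries.mk fun i => if h : 0 < i then A (i.toPNat h) else 0 with hP
  have hP0 : PowerSeries.coeff 0 P = 0 := by simp [hP]
  have hcomm : Commute P (eulerOp P) := by
    ext j : 1
    rw [PowerSeries.coeff_mul, PowerSeries.coeff_mul, ← Finset.Nat.sum_antidiagonal_swap]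
    refine Finset.sum_congr rfl fun p _ => ?_
    simp only [eulerOp, PowerSeries.coeff_mk, hP, Prod.fst_swap, Prod.snd_swap, mul_smul_comm,
      smul_mul_assoc]
    congr 1
    split_ifs
    · exact hA _ _
    all_goals simp
  have hcoeff : ∀ i M : ℕ, i < M → PowerSeries.coeff i (expSeries A) =
      ∑ m ∈ Finset.range M, ((m.factorial : ℂ)⁻¹) • PowerSeries.coeff i (P ^ m) := by
    intro i M hM
    rw [expSeries, PowerSeries.coeff_mk]
    refine Finset.sum_subset (Finset.range_mono hM) fun m _ hm => ?_
    rw [coeff_pow_eq_zero hP0 (by simpa [Nat.lt_succ_iff] using hm), smul_zero]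
  have hstep : ∀ m, (j : ℂ) • PowerSeries.coeff j (P ^ (m + 1)) = ((m + 1 : ℕ) : ℂ) •
      ∑ p ∈ Finset.HasAntidiagonal.antidiagonal j, (p.1 : ℂ) • (PowerSeries.coeff p.1 P *
        PowerSeries.coeff p.2 (P ^ m)) := by
    intro m
    have h := congrArg (PowerSeries.coeff j) (eulerOp_pow hcomm m)
    simp only [eulerOp, PowerSeries.coeff_mk, map_nsmul, PowerSeries.coeff_mul, smul_mul_assoc]
      at h
    simpa only [Nat.cast_smul_eq_nsmul] using h
  rcases Nat.eq_zero_or_pos j with rfl | hj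
  · simp
  rw [hcoeff j (j + 1) (Nat.lt_succ_self j), Finset.sum_range_succ', smul_add, Finset.smul_sum]
  have h0 : PowerSeries.coeff j (P ^ 0) = 0 := by
    rw [pow_zero, PowerSeries.coeff_one, if_neg hj.ne']
  rw [h0, smul_zero, smul_zero, add_zero]
  have h1 : ∀ m ∈ Finset.range j, (j : ℂ) • (((m + 1).factorial : ℂ)⁻¹ •
      PowerSeries.coeff j (P ^ (m + 1))) = ∑ p ∈ Finset.HasAntidiagonal.antidiagonal j,
        (p.1 : ℂ) • (PowerSeries.coeff p.1 P *
          (((m.factorial : ℂ)⁻¹) • PowerSeries.coeff p.2 (P ^ m))) := by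
    intro m _
    rw [smul_comm, hstep, smul_smul, Finset.smul_sum]
    refine Finset.sum_congr rfl fun p _ => ?_
    rw [mul_smul_comm, smul_comm]
    congr 2
    rw [Nat.factorial_succ]
    have : ((m + 1 : ℕ) : ℂ) ≠ 0 := Nat.cast_ne_zero.2 m.succ_ne_zero
    push_cast at this ⊢
    field_simp
  rw [Finset.sum_congr rfl h1, Finset.sum_comm]
  refine Finset.sum_congr rfl fun p hp => ?_
  rw [← Finset.smul_sum, ← Finset.mul_sum]
  have hp' := Finset.HasAntidiagonal.mem_antidiagonal.1 hp
  rcases Nat.eq_zero_or_pos p.1 with h | h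
  · simp [h]
  · rw [← hcoeff p.2 j (by omega), hP, PowerSeries.coeff_mk]

theorem finite_weight_eq (j : ℕ) : {lam : ℕ+ →₀ ℕ | Finsupp.weight wt lam = j}.Finite := by
  let B : ℕ+ →₀ ℕ := Finsupp.onFinset (Finset.Icc 1 j.succPNat)
    (fun m => if m ≤ j.succPNat then j else 0)
    (by intro m hm; simp at hm; simp [hm.1])
  refine (Set.finite_Iic B).subset fun lam h m => ?_
  have h1 : m * lam m ≤ j := by
    rw [← (h : Finsupp.weight wt lam = j), Finsupp.weight_apply, Finsupp.sum]
    by_cases hm : m ∈ lam.support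
    · refine le_trans (le_of_eq ?_)
        (Finset.single_le_sum (f := fun a => lam a • wt a) (fun _ _ => Nat.zero_le _) hm)
      simp [wt, mul_comm]
    · simp [Finsupp.notMem_support_iff.1 hm]
  rcases Nat.eq_zero_or_pos (lam m) with h0 | h0
  · simp [h0]
  · have h2 : (m : ℕ) ≤ j := le_trans (Nat.le_mul_of_pos_right _ h0) h1
    have h3 : lam m ≤ j := le_trans (Nat.le_mul_of_pos_left _ m.pos) h1
    have h4 : m ≤ j.succPNat := by
      rw [← PNat.coe_le_coe, Nat.succPNat_coe]
      omega
    simpa [B, h4] using h3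

/-- The exponents of the monomials of degree `j`; these are the partitions of `j`. -/
def wtFinset (j : ℕ) : Finset (ℕ+ →₀ ℕ) := (finite_weight_eq j).toFinset

@[simp]
theorem mem_wtFinset {j : ℕ} {lam : ℕ+ →₀ ℕ} :
    lam ∈ wtFinset j ↔ Finsupp.weight wt lam = j := by
  simp [wtFinset]

theorem weight_add_single (lam : ℕ+ →₀ ℕ) (m : ℕ+) :
    Finsupp.weight wt (lam + Finsupp.single m 1) = Finsupp.weight wt lam + m := by
  rw [map_add, Finsupp.weight_single, one_smul, wt]

/-- The coefficients of `exp (∑ A_n xⁿ)`, for commuting `A_n`, in terms of divided powers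
`P lam = ∏ A_n^{lam n} / (lam n)! • P 0`. -/
theorem coeff_expSeries_apply {A : ℕ+ → Module.End ℂ Fock} (hA : ∀ m n, Commute (A m) (A n))
    {P : (ℕ+ →₀ ℕ) → Fock}
    (hP : ∀ lam m, ((lam m + 1 : ℕ) : ℂ) • P (lam + Finsupp.single m 1) = A m (P lam)) (j : ℕ) :
    PowerSeries.coeff j (expSeries A) (P 0) = ∑ lam ∈ wtFinset j, P lam := by
  induction j using Nat.strong_induction_on with
  | _ j ih =>
  rcases Nat.eq_zero_or_pos j with rfl | hj
  · have : wtFinset 0 = {0} := by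
      ext lam
      rw [mem_wtFinset, Finset.mem_singleton]
      refine ⟨fun h => ?_, fun h => by simp [h]⟩
      ext m
      rw [Finsupp.weight_apply, Finsupp.sum, Finset.sum_eq_zero_iff] at h
      by_contra h0
      have := h m (Finsupp.mem_support_iff.2 h0)
      simp [wt] at this
      exact h0 this
    simp [this, expSeries]
  have hj' : (j : ℂ) ≠ 0 := Nat.cast_ne_zero.2 hj.ne'
  refine smul_right_injective Fock hj' ?_
  change (j : ℂ) • (PowerSeries.coeff j (expSeries A)) (P 0) = (j : ℂ) • ∑ lam ∈ wtFinset j, P lam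
  have hl : (j : ℂ) • (PowerSeries.coeff j (expSeries A)) (P 0) =
      ∑ p ∈ (Finset.HasAntidiagonal.antidiagonal j).filter fun p => 0 < p.1, ∑ lam ∈ wtFinset p.2,
        (p.1 : ℂ) • (if h : 0 < p.1 then A (p.1.toPNat h) else 0) (P lam) := by
    rw [← LinearMap.smul_apply, smul_coeff_expSeries hA, LinearMap.sum_apply, Finset.sum_filter]
    refine Finset.sum_congr rfl fun p hp => ?_
    have hp' := Finset.HasAntidiagonal.mem_antidiagonal.1 hp
    split_ifs with h
    · rw [LinearMap.smul_apply, Module.End.mul_apply, ih p.2 (by omega), map_sum,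
        Finset.smul_sum]
    · simp [show p.1 = 0 by omega]
  have hr : (j : ℂ) • ∑ lam ∈ wtFinset j, P lam =
      ∑ lam ∈ wtFinset j, ∑ m ∈ lam.support, ((lam m : ℂ) * ((m : ℕ) : ℂ)) • P lam := by
    rw [Finset.smul_sum]
    refine Finset.sum_congr rfl fun lam hlam => ?_
    rw [← Finset.sum_smul]
    congr 1
    rw [← mem_wtFinset.1 hlam, Finsupp.weight_apply, Finsupp.sum]
    push_cast
    exact Finset.sum_congr rfl fun m _ => by simp [wt]
  rw [hl, hr, Finset.sum_sigma', Finset.sum_sigma']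
  -- Removing one box of size `m` from a partition of `j` leaves a partition of `j - m`.
  refine Finset.sum_bij'
    (i := fun x hx => ⟨x.2 + Finsupp.single (x.1.1.toPNat (by
      simp only [Finset.mem_sigma, Finset.mem_filter] at hx; exact hx.1.2)) 1,
        x.1.1.toPNat (by
      simp only [Finset.mem_sigma, Finset.mem_filter] at hx; exact hx.1.2)⟩)
    (j := fun y _ => ⟨((y.2 : ℕ), j - y.2), y.1 - Finsupp.single y.2 1⟩) ?_ ?_ ?_ ?_ ?_
  · rintro ⟨p, lam⟩ hx
    simp only [Finset.mem_sigma, Finset.mem_filter,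
      Finset.HasAntidiagonal.mem_antidiagonal, mem_wtFinset] at hx ⊢
    refine ⟨?_, by simp⟩
    rw [weight_add_single, hx.2]
    exact (add_comm _ _).trans hx.1.1
  · rintro ⟨lam, m⟩ hy
    simp only [Finset.mem_sigma, Finset.mem_filter,
      Finset.HasAntidiagonal.mem_antidiagonal, mem_wtFinset,
      Finsupp.mem_support_iff] at hy ⊢
    have hle : Finsupp.single m 1 ≤ lam := Finsupp.single_le_iff.2 (by omega)
    have h := weight_add_single (lam - Finsupp.single m 1) m
    rw [tsub_add_cancel_of_le hle, hy.1] at h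
    exact ⟨⟨by omega, m.pos⟩, by omega⟩
  · rintro ⟨⟨a, b⟩, lam⟩ hx
    simp only [Finset.mem_sigma, Finset.mem_filter,
      Finset.HasAntidiagonal.mem_antidiagonal, mem_wtFinset] at hx
    have hb : j - a = b := by omega
    simp only [add_tsub_cancel_right]
    simp [hb, Nat.toPNat]
  · rintro ⟨lam, m⟩ hy
    simp only [Finset.mem_sigma, Finsupp.mem_support_iff] at hy
    have hle : Finsupp.single m 1 ≤ lam := Finsupp.single_le_iff.2 (by omega)
    have hm : Nat.toPNat (m : ℕ) m.pos = m := PNat.eq rfl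
    simp only [hm, tsub_add_cancel_of_le hle]
  · rintro ⟨⟨a, b⟩, lam⟩ hx
    simp only [Finset.mem_sigma, Finset.mem_filter] at hx
    simp only [dif_pos hx.1.2]
    rw [← hP, smul_smul]
    congr 1
    rw [mul_comm, Finsupp.add_apply, Finsupp.single_eq_same]
    rfl

/-! ### Vertex operators in the monomial basis -/

/-- Compare the values at `lam + single m 1` and at `lam` of a product over the parts. -/
theorem exists_prod_add_single {g : ℕ+ → ℕ → ℂ} (hg : ∀ m, g m 0 = 1) (lam : ℕ+ →₀ ℕ) (m : ℕ+) :
    ∃ c, (lam + Finsupp.single m 1).prod g = g m (lam m + 1) * c ∧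
      lam.prod g = g m (lam m) * c := by
  refine ⟨(lam.erase m).prod g, ?_, (Finsupp.mul_prod_erase' lam m g fun i => hg i).symm⟩
  have h : (lam + Finsupp.single m 1).erase m = lam.erase m := by
    simp [Finsupp.erase_add]
  rw [← Finsupp.mul_prod_erase' _ m g fun i => hg i, h]
  simp

/-- The coefficient of `x^lam` in `exp (∑ aₘ xₘ)`. -/
def creationWt (a : ℕ+ → ℂ) (lam : ℕ+ →₀ ℕ) : ℂ :=
  lam.prod fun m k => a m ^ k / (k.factorial : ℂ)

/-- The coefficient of `x^{ν - ρ}` in `exp (∑ bₘ ∂ₘ) x^ν`; it is zero unless `ρ ≤ ν`. -/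
def annihilationWt (b : ℕ+ → ℂ) (ν rho : ℕ+ →₀ ℕ) : ℂ :=
  rho.prod fun m k => b m ^ k * ((ν m).choose k : ℂ)

theorem annihilationWt_eq_zero {b : ℕ+ → ℂ} {ν rho : ℕ+ →₀ ℕ} (h : ¬ rho ≤ ν) :
    annihilationWt b ν rho = 0 := by
  obtain ⟨m, hm⟩ : ∃ m, ν m < rho m := by simpa [Finsupp.le_def] using h
  refine Finset.prod_eq_zero (Finsupp.mem_support_iff.2 (by omega : rho m ≠ 0)) ?_
  simp [Nat.choose_eq_zero_of_lt hm]

theorem coeff_Yminus_monomial (β : ℂ) (j : ℕ) (ν : ℕ+ →₀ ℕ) (c : ℂ) :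
    PowerSeries.coeff j (Yminus β) (MvPolynomial.monomial ν c) =
      ∑ lam ∈ wtFinset j, MvPolynomial.monomial (ν + lam)
        (c * creationWt (fun m => β / (m : ℂ)) lam) := by
  have h := coeff_expSeries_apply (A := fun n : ℕ+ => (β / (n : ℂ)) • aNeg n)
    (P := fun lam => MvPolynomial.monomial (ν + lam) (c * creationWt (fun m => β / (m : ℂ)) lam))
    (fun m n => by
      refine Commute.smul_left (Commute.smul_right ?_ _) _
      refine LinearMap.ext fun u => ?_
      simp only [aNeg, Module.End.mul_apply, LinearMap.mulLeft_apply]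
      ring)
    (fun lam m => ?_) j
  · simpa [creationWt, Yminus] using h
  · obtain ⟨e, h1, h2⟩ := exists_prod_add_single
      (g := fun m k => (β / (m : ℂ)) ^ k / (k.factorial : ℂ)) (fun m => by simp) lam m
    simp only [creationWt, h1, h2, LinearMap.smul_apply, aNeg, LinearMap.mulLeft_apply,
      MvPolynomial.X, MvPolynomial.monomial_mul, MvPolynomial.smul_monomial, smul_eq_mul]
    congr 1
    · rw [add_comm (Finsupp.single m 1), add_assoc]
    · rw [Nat.factorial_succ, pow_succ]
      have h3 : ((lam m + 1 : ℕ) : ℂ) ≠ 0 := Nat.cast_ne_zero.2 (Nat.succ_ne_zero _)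
      have h4 : ((lam m).factorial : ℂ) ≠ 0 := Nat.cast_ne_zero.2 (Nat.factorial_ne_zero _)
      push_cast at h3 ⊢
      field_simp

theorem pderiv_comm (m n : ℕ+) (u : Fock) :
    MvPolynomial.pderiv m (MvPolynomial.pderiv n u) =
      MvPolynomial.pderiv n (MvPolynomial.pderiv m u) := by
  by_cases h : m = n
  · rw [h]
  · ext μ
    simp only [MvPolynomial.coeff_pderiv, Finsupp.add_apply, Finsupp.single_eq_of_ne h,
      Finsupp.single_eq_of_ne (Ne.symm h), add_zero]
    rw [add_right_comm, mul_right_comm]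

theorem coeff_Yplus_monomial (β : ℂ) (j : ℕ) (ν : ℕ+ →₀ ℕ) (c : ℂ) :
    PowerSeries.coeff j (Yplus β) (MvPolynomial.monomial ν c) =
      ∑ rho ∈ wtFinset j, MvPolynomial.monomial (ν - rho)
        (c * annihilationWt (fun _ => -β) ν rho) := by
  have h := coeff_expSeries_apply (A := fun n : ℕ+ => (-β / (n : ℂ)) • aPos n)
    (P := fun rho => MvPolynomial.monomial (ν - rho) (c * annihilationWt (fun _ => -β) ν rho))
    (fun m n => by
      refine Commute.smul_left (Commute.smul_right ?_ _) _
      refine Commute.smul_left (Commute.smul_right ?_ _) _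
      refine LinearMap.ext fun u => ?_
      simp only [Module.End.mul_apply, Derivation.coeFn_coe]
      exact pderiv_comm _ _ _)
    (fun lam m => ?_) j
  · simpa [annihilationWt, Yplus] using h
  · obtain ⟨e, h1, h2⟩ := exists_prod_add_single
      (g := fun m k => (-β) ^ k * ((ν m).choose k : ℂ)) (fun m => by simp) lam m
    simp only [annihilationWt, h1, h2, LinearMap.smul_apply, aPos, Derivation.coeFn_coe,
      MvPolynomial.pderiv_monomial, MvPolynomial.smul_monomial, smul_eq_mul]
    congr 1
    · rw [tsub_tsub]
    · have h3 : ((m : ℕ) : ℂ) ≠ 0 := Nat.cast_ne_zero.2 m.ne_zero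
      have h4 := congrArg (Nat.cast (R := ℂ)) (Nat.choose_succ_right_eq (ν m) (lam m))
      rw [Finsupp.tsub_apply, pow_succ]
      push_cast at h4 ⊢
      field_simp
      linear_combination (-β) ^ (lam m) * (-β) * c * e * h4

/-- The coefficient of `x^{ν - ρ + λ}` in the `(λ, ρ)`-term of
`exp (∑ aₘ xₘ) exp (∑ bₘ ∂ₘ)` applied to `x^ν`, for `p = (λ, ρ)`. -/
def multiStepWt (a b : ℕ+ → ℂ) (p : (ℕ+ →₀ ℕ) × (ℕ+ →₀ ℕ)) (ν : ℕ+ →₀ ℕ) : ℂ :=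
  creationWt a p.1 * annihilationWt b ν p.2

/-- The change of degree `|λ| - |ρ|` for `p = (λ, ρ)`. -/
def degShift (p : (ℕ+ →₀ ℕ) × (ℕ+ →₀ ℕ)) : ℤ :=
  (Finsupp.weight wt p.1 : ℤ) - Finsupp.weight wt p.2

/-- The coefficients of `oscMode β k` applied to `x^ν`. -/
def oscWt (β : ℂ) (k : ℤ) (ν : ℕ+ →₀ ℕ) (p : (ℕ+ →₀ ℕ) × (ℕ+ →₀ ℕ)) : ℂ :=
  if degShift p = k then multiStepWt (fun m => β / (m : ℂ)) (fun _ => -β) p ν else 0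

theorem finite_support_oscWt (β : ℂ) (k : ℤ) (ν : ℕ+ →₀ ℕ) :
    (Function.support (oscWt β k ν)).Finite := by
  have h : (⋃ rho ∈ Set.Iic ν, (fun lam => (lam, rho)) ''
      (wtFinset (k + Finsupp.weight wt rho).toNat : Set (ℕ+ →₀ ℕ))).Finite :=
    (Set.finite_Iic ν).biUnion fun rho _ => (Finset.finite_toSet _).image _
  refine h.subset ?_
  rintro ⟨lam, rho⟩ hp
  rw [Function.mem_support, oscWt, ne_eq, ite_eq_right_iff, Classical.not_imp] at hp
  have hle : rho ≤ ν := by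
    by_contra h0
    exact hp.2 (by rw [multiStepWt, annihilationWt_eq_zero h0, mul_zero])
  have hdeg := hp.1
  simp only [degShift] at hdeg
  refine Set.mem_biUnion hle ⟨lam, ?_, rfl⟩
  rw [Finset.mem_coe, mem_wtFinset]
  omega

/-- The sum over the pairs `(lam, rho)`, of which only finitely many contribute, computes
`oscMode β k` on monomials; it is tested against linear functionals. -/
theorem hasSum_oscMode (β : ℂ) (k : ℤ) (ν : ℕ+ →₀ ℕ) (φ : Fock →ₗ[ℂ] ℂ) :
    HasSum (fun p => oscWt β k ν p * φ (MvPolynomial.monomial (ν - p.2 + p.1) 1))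
      (φ (oscMode β k (MvPolynomial.monomial ν 1))) := by
  set f : (ℕ+ →₀ ℕ) × (ℕ+ →₀ ℕ) → ℂ :=
    fun p => oscWt β k ν p * φ (MvPolynomial.monomial (ν - p.2 + p.1) 1) with hf
  have hfin : (Function.support f).Finite :=
    (finite_support_oscWt β k ν).subset fun p hp h0 => hp (by simp [hf, h0])
  have hs : Summable f := summable_of_hasFiniteSupport hfin
  have hmono : ∀ (μ : ℕ+ →₀ ℕ) (c : ℂ),
      φ (MvPolynomial.monomial μ c) = c * φ (MvPolynomial.monomial μ 1) := by
    intro μ c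
    rw [← smul_eq_mul, ← map_smul, MvPolynomial.smul_monomial, smul_eq_mul, mul_one]
  -- The sum over `lam` for fixed `rho`.
  have h1 : ∀ rho, ∑' lam, f (lam, rho) = φ (intCoeff (k + Finsupp.weight wt rho) (Yminus β)
      (MvPolynomial.monomial (ν - rho) (annihilationWt (fun _ => -β) ν rho))) := by
    intro rho
    rw [intCoeff]
    split_ifs with h
    · rw [coeff_Yminus_monomial, map_sum, tsum_eq_sum
        (s := wtFinset (k + Finsupp.weight wt rho).toNat)]
      · refine Finset.sum_congr rfl fun lam hlam => ?_
        rw [mem_wtFinset] at hlam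
        have hd : degShift (lam, rho) = k := by
          simp only [degShift]
          omega
        rw [hf, hmono _ (_ * _)]
        simp only [oscWt, if_pos hd, multiStepWt]
        ring
      · intro lam hlam
        rw [mem_wtFinset] at hlam
        have hd : degShift (lam, rho) ≠ k := by
          simp only [degShift]
          omega
        simp [hf, oscWt, hd]
    · rw [LinearMap.zero_apply, map_zero]
      refine (tsum_congr fun lam => ?_).trans tsum_zero
      have hd : degShift (lam, rho) ≠ k := by
        simp only [degShift]
        omega
      simp [hf, oscWt, hd]
  have hs' := (Equiv.prodComm _ _).summable_iff.2 hs
  have h2 := hs'.hasSum.prod_fiberwise fun rho => (hs'.prod_factor rho).hasSum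
  have h2' := (Equiv.prodComm (ℕ+ →₀ ℕ) (ℕ+ →₀ ℕ)).tsum_eq f
  simp only [Function.comp_apply, Equiv.prodComm_apply, Prod.swap_prod_mk] at h2
  simp only [Equiv.prodComm_apply] at h2'
  rw [h2'] at h2
  have h3 := h2.tsum_fiberwise (Finsupp.weight wt)
  have h4 : φ (oscMode β k (MvPolynomial.monomial ν 1)) = ∑' l : ℕ,
      ∑' rho : Finsupp.weight wt ⁻¹' {l}, ∑' lam, f (lam, rho.1) := by
    have hfin' : (Function.support fun l : ℕ => (intCoeff (k + l) (Yminus β) *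
        PowerSeries.coeff l (Yplus β)) (MvPolynomial.monomial ν 1)).Finite :=
      (finite_support_of_lowers (lowers_coeff_Yplus β) (MvPolynomial.monomial ν 1)).subset
        fun l hl h0 => hl (by
          have h0' : (PowerSeries.coeff l (Yplus β)) (MvPolynomial.monomial ν 1) = 0 := h0
          simp [h0'])
    change φ (∑ᶠ l : ℕ, (intCoeff (k + l) (Yminus β) * PowerSeries.coeff l (Yplus β))
      (MvPolynomial.monomial ν 1)) = _
    rw [map_finsum φ hfin', ← tsum_eq_finsum (L := SummationFilter.unconditional ℕ)
      (hfin'.subset fun l hl h0 => hl (by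
      simp only [h0, map_zero]))]
    refine tsum_congr fun l => ?_
    have hset : Finsupp.weight wt ⁻¹' {l} = (wtFinset l : Set (ℕ+ →₀ ℕ)) := by
      ext rho
      simp
    rw [hset, Finset.tsum_subtype' (wtFinset l) fun rho => ∑' lam, f (lam, rho),
      Module.End.mul_apply, coeff_Yplus_monomial, map_sum, map_sum]
    refine Finset.sum_congr rfl fun rho hrho => ?_
    rw [h1, mem_wtFinset.1 hrho, one_mul]
  rw [h4]
  have h5 := hs.hasSum
  rwa [← h3.tsum_eq] at h5

/-- The coefficient of `x^{pathEnd s μ}` in the `s`-term of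
`exp (∑ a₁ₘ xₘ) exp (∑ b₁ₘ ∂ₘ) ⋯ exp (∑ aₙₘ xₘ) exp (∑ bₙₘ ∂ₘ)` applied to `x^μ`. -/
def multiPathWt : {n : ℕ} → (a b : Fin n → ℕ+ → ℂ) →
    (Fin n → (ℕ+ →₀ ℕ) × (ℕ+ →₀ ℕ)) → (ℕ+ →₀ ℕ) → ℂ
  | 0, _, _, _, _ => 1
  | _ + 1, a, b, s, μ => multiPathWt (Fin.tail a) (Fin.tail b) (Fin.tail s) μ *
      multiStepWt (a 0) (b 0) (s 0) (pathEnd (Fin.tail s) μ)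

/-- The coefficients of the product of the operators `oscMode (β i) (k i)` applied to `x^μ`. -/
def oscPathWt {n : ℕ} (β : Fin n → ℂ) (k : Fin n → ℤ) (s : Fin n → (ℕ+ →₀ ℕ) × (ℕ+ →₀ ℕ))
    (μ : ℕ+ →₀ ℕ) : ℂ :=
  if ∀ i, degShift (s i) = k i then
    multiPathWt (fun i m => β i / (m : ℂ)) (fun i _ => -β i) s μ else 0

theorem oscPathWt_cons {n : ℕ} (β : Fin (n + 1) → ℂ) (k : Fin (n + 1) → ℤ)
    (p : (ℕ+ →₀ ℕ) × (ℕ+ →₀ ℕ)) (s : Fin n → (ℕ+ →₀ ℕ) × (ℕ+ →₀ ℕ)) (μ : ℕ+ →₀ ℕ) :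
    oscPathWt β k (Fin.cons p s) μ = oscPathWt (Fin.tail β) (Fin.tail k) s μ *
      oscWt (β 0) (k 0) (pathEnd s μ) p := by
  simp only [oscPathWt, oscWt, Fin.forall_fin_succ, Fin.cons_zero, Fin.cons_succ, multiPathWt,
    Fin.tail_cons]
  by_cases h1 : degShift p = k 0
  · by_cases h2 : ∀ i, degShift (s i) = Fin.tail k i
    · rw [if_pos ⟨h1, h2⟩, if_pos h2, if_pos h1]
      rfl
    · rw [if_neg fun h => h2 h.2, if_neg h2, zero_mul]
  · rw [if_neg fun h => h1 h.1, if_neg h1, mul_zero]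

/-- Only finitely many families of pairs contribute to a product of the operators `oscMode`, so that
the sum that computes it may be tested against linear functionals. -/
theorem hasSum_oscMode_prod {n : ℕ} (β : Fin n → ℂ) (k : Fin n → ℤ) (μ : ℕ+ →₀ ℕ) :
    (Function.support fun s => oscPathWt β k s μ).Finite ∧ ∀ φ : Fock →ₗ[ℂ] ℂ,
      HasSum (fun s => oscPathWt β k s μ * φ (MvPolynomial.monomial (pathEnd s μ) 1))
        (φ ((List.ofFn fun i => oscMode (β i) (k i)).prod (MvPolynomial.monomial μ 1))) := by
  induction n with
  | zero =>
    refine ⟨Set.toFinite _, fun φ => ?_⟩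
    simp [oscPathWt, multiPathWt, pathEnd]
  | succ n ih =>
    obtain ⟨hfin, hsum⟩ := ih (Fin.tail β) (Fin.tail k)
    let e : (Fin n → (ℕ+ →₀ ℕ) × (ℕ+ →₀ ℕ)) × ((ℕ+ →₀ ℕ) × (ℕ+ →₀ ℕ)) ≃
        (Fin (n + 1) → (ℕ+ →₀ ℕ) × (ℕ+ →₀ ℕ)) :=
      (Equiv.prodComm _ _).trans (Fin.consEquiv fun _ => (ℕ+ →₀ ℕ) × (ℕ+ →₀ ℕ))
    have he : ∀ s p, e (s, p) = Fin.cons p s := fun _ _ => rfl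
    have hfin' : (Function.support fun s => oscPathWt β k s μ).Finite := by
      have h : (⋃ s ∈ Function.support fun s => oscPathWt (Fin.tail β) (Fin.tail k) s μ,
          (fun p => e (s, p)) '' Function.support (oscWt (β 0) (k 0) (pathEnd s μ))).Finite :=
        hfin.biUnion fun s _ => (finite_support_oscWt _ _ _).image _
      refine h.subset fun t ht => ?_
      obtain ⟨⟨s, p⟩, rfl⟩ := e.surjective t
      rw [Function.mem_support, he, oscPathWt_cons] at ht
      exact Set.mem_biUnion (x := s) (left_ne_zero_of_mul ht)
        ⟨p, right_ne_zero_of_mul ht, rfl⟩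
    refine ⟨hfin', fun φ => ?_⟩
    have htot : Summable fun s =>
        oscPathWt β k s μ * φ (MvPolynomial.monomial (pathEnd s μ) 1) :=
      summable_of_hasFiniteSupport (hfin'.subset fun s hs h0 => hs (by
        simp only [show oscPathWt β k s μ = 0 from h0, zero_mul]))
    have h1 := (e.summable_iff.2 htot).hasSum
    have h2 := h1.prod_fiberwise
      (g := fun s => oscPathWt (Fin.tail β) (Fin.tail k) s μ *
        (φ ∘ₗ oscMode (β 0) (k 0)) (MvPolynomial.monomial (pathEnd s μ) 1)) fun s => by
      convert! (hasSum_oscMode (β 0) (k 0) (pathEnd s μ) φ).mul_left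
        (oscPathWt (Fin.tail β) (Fin.tail k) s μ) using 2 with p
      rw [Function.comp_apply, he, oscPathWt_cons, mul_assoc]
      rfl
    have h3 := h2.unique (hsum (φ ∘ₗ oscMode (β 0) (k 0)))
    rw [h3] at h1
    rw [← e.hasSum_iff, List.ofFn_succ, List.prod_cons]
    exact h1

/-! ### The trace over a graded piece -/

/-- The exponents of `x₁, …, xₙ` at which the product of the vertex operators acts on `M ⊗ e^γ` by
`oscMode (β 1) (k 1) ⋯ oscMode (β n) (k n)`. -/
def exponents {n : ℕ} (γ : ℂ) (β : Fin n → ℂ) (k : Fin n → ℤ) (i : Fin n) : ℂ :=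
  β i * (γ + ∑ j with i < j, β j) + k i

theorem exponents_zero {n : ℕ} (γ : ℂ) (β : Fin (n + 1) → ℂ) (k : Fin (n + 1) → ℤ) :
    exponents γ β k 0 = β 0 * (γ + ∑ i, Fin.tail β i) + k 0 := by
  simp [exponents, Finset.sum_filter, Fin.sum_univ_succ, Fin.tail]

theorem exponents_succ {n : ℕ} (γ : ℂ) (β : Fin (n + 1) → ℂ) (k : Fin (n + 1) → ℤ) (i : Fin n) :
    exponents γ β k i.succ = exponents γ (Fin.tail β) (Fin.tail k) i := by
  simp [exponents, Finset.sum_filter, Fin.sum_univ_succ, Fin.tail]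

theorem exponents_injective {n : ℕ} (γ : ℂ) (β : Fin n → ℂ) :
    Function.Injective (exponents γ β) := by
  intro k l h
  ext i
  have := congrFun h i
  simpa [exponents] using this

theorem injective_add_intCast (c : ℂ) : Function.Injective fun k : ℤ => c + (k : ℂ) :=
  fun k l h => by simpa using h

theorem vertexCoeff_single (β γ : ℂ) (k : ℤ) (u : Fock) :
    vertexCoeff β (β * γ + k) (Finsupp.single γ u) = Finsupp.single (γ + β) (oscMode β k u) := by
  rw [vertexCoeff, Finsupp.lsum_single, (injective_add_intCast (β * γ)).extend_apply]
  rfl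

theorem vertexCoeff_single_of_forall_ne {β γ s : ℂ} (h : ∀ k : ℤ, β * γ + k ≠ s) (u : Fock) :
    vertexCoeff β s (Finsupp.single γ u) = 0 := by
  rw [vertexCoeff, Finsupp.lsum_single, Function.extend_apply']
  · rfl
  · rintro ⟨k, hk⟩
    exact h k hk

theorem vertexCoeff_prod_single {n : ℕ} (γ : ℂ) (β : Fin n → ℂ) (k : Fin n → ℤ) (u : Fock) :
    (List.ofFn fun i => vertexCoeff (β i) (exponents γ β k i)).prod (Finsupp.single γ u) =
      Finsupp.single (γ + ∑ i, β i) ((List.ofFn fun i => oscMode (β i) (k i)).prod u) := by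
  induction n with
  | zero => simp
  | succ n ih =>
    rw [List.ofFn_succ, List.ofFn_succ, List.prod_cons, List.prod_cons, Module.End.mul_apply,
      Module.End.mul_apply]
    simp only [exponents_succ]
    have h := ih (Fin.tail β) (Fin.tail k)
    simp only [Fin.tail] at h ⊢
    rw [h, exponents_zero]
    simp only [Fin.tail]
    rw [vertexCoeff_single, Fin.sum_univ_succ, add_assoc, add_comm (β 0)]

theorem vertexCoeff_prod_single_eq_zero {n : ℕ} {γ : ℂ} {β s : Fin n → ℂ}
    (hs : s ∉ Set.range (exponents γ β)) (u : Fock) :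
    (List.ofFn fun i => vertexCoeff (β i) (s i)).prod (Finsupp.single γ u) = 0 := by
  induction n with
  | zero => exact absurd ⟨Fin.elim0, Subsingleton.elim _ _⟩ hs
  | succ n ih =>
    rw [List.ofFn_succ, List.prod_cons, Module.End.mul_apply]
    by_cases h : Fin.tail s ∈ Set.range (exponents γ (Fin.tail β))
    · obtain ⟨k, hk⟩ := h
      have h1 := vertexCoeff_prod_single γ (Fin.tail β) k u
      rw [hk] at h1
      simp only [Fin.tail] at h1
      rw [h1]
      refine vertexCoeff_single_of_forall_ne (fun k0 hk0 => hs ⟨Fin.cons k0 k, ?_⟩) _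
      ext i
      refine Fin.cases ?_ (fun i => ?_) i
      · rw [exponents_zero, Fin.cons_zero, ← hk0]
        rfl
      · rw [exponents_succ, Fin.tail_cons, hk]
        rfl
    · have h1 := ih h
      simp only [Fin.tail] at h1
      rw [h1, map_zero]

/-- Coordinates on `level N` with respect to the monomials of degree `N`. -/
def levelEquiv (N : ℕ) : level N ≃ₗ[ℂ] (wtFinset N → ℂ) where
  toFun u μ := MvPolynomial.coeff μ.1 u.1
  map_add' u v := by
    ext μ
    simp
  map_smul' c u := by
    ext μ
    simp
  invFun f := ⟨∑ μ : wtFinset N, MvPolynomial.monomial μ.1 (f μ),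
    Submodule.sum_mem _ fun μ _ =>
      MvPolynomial.isWeightedHomogeneous_monomial wt μ.1 (f μ) (mem_wtFinset.1 μ.2)⟩
  left_inv u := by
    refine Subtype.ext ?_
    ext ν
    simp only [MvPolynomial.coeff_sum, MvPolynomial.coeff_monomial]
    by_cases hν : ν ∈ wtFinset N
    · rw [Finset.sum_eq_single (⟨ν, hν⟩ : wtFinset N)]
      · simp
      · intro μ _ hμ
        rw [if_neg fun h => hμ (Subtype.ext h)]
      · simp
    · rw [Finset.sum_eq_zero]
      · by_contra h
        exact hν (mem_wtFinset.2 (u.2 (Ne.symm h)))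
      · intro μ _
        exact if_neg fun h : μ.1 = ν => hν (h ▸ μ.2)
  right_inv f := by
    ext ν
    simp only [MvPolynomial.coeff_sum, MvPolynomial.coeff_monomial]
    rw [Finset.sum_eq_single ν]
    · simp
    · intro μ _ hμ
      rw [if_neg fun h => hμ (Subtype.ext h)]
    · simp

theorem levelTrace_eq_sum (α : ℂ) (N : ℕ) (A : Module.End ℂ GenFock) :
    levelTrace α N A = ∑ μ ∈ wtFinset N,
      MvPolynomial.coeff μ (A (Finsupp.single α (MvPolynomial.monomial μ 1)) α) := by
  classical
  let b := Module.Basis.ofEquivFun (levelEquiv N)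
  rw [levelTrace, LinearMap.trace_eq_matrix_trace ℂ b, Matrix.trace,
    ← Finset.sum_coe_sort (wtFinset N)]
  refine Finset.sum_congr rfl fun μ _ => ?_
  have hb : ((b μ : level N) : Fock) = MvPolynomial.monomial μ.1 1 := by
    rw [Module.Basis.coe_ofEquivFun]
    change ∑ ν : wtFinset N, MvPolynomial.monomial ν.1 (Pi.single μ (1 : ℂ) ν) = _
    rw [Finset.sum_eq_single μ]
    · simp
    · intro ν _ hν
      simp [hν]
    · simp
  rw [Matrix.diag_apply, LinearMap.toMatrix_apply, Module.Basis.ofEquivFun_repr_apply]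
  change MvPolynomial.coeff μ.1 (MvPolynomial.weightedHomogeneousComponent wt N
    (A (Finsupp.single α ((b μ : level N) : Fock)) α)) = _
  rw [hb, MvPolynomial.coeff_weightedHomogeneousComponent, if_pos (mem_wtFinset.1 μ.2)]

/-- Charge neutrality makes the product of the vertex operators map `M ⊗ e^α` to itself. -/
theorem levelTrace_exponents {n : ℕ} (α : ℂ) {β : Fin n → ℂ} (hβ : ∑ i, β i = 0) (N : ℕ)
    (k : Fin n → ℤ) :
    levelTrace α N (List.ofFn fun i => vertexCoeff (β i) (exponents α β k i)).prod =
      ∑ μ ∈ wtFinset N, ∑' s, if pathEnd s μ = μ then oscPathWt β k s μ else 0 := by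
  rw [levelTrace_eq_sum]
  refine Finset.sum_congr rfl fun μ _ => ?_
  rw [vertexCoeff_prod_single, hβ, add_zero, Finsupp.single_eq_same]
  have h := (hasSum_oscMode_prod β k μ).2 (MvPolynomial.lcoeff ℂ μ)
  simp only [MvPolynomial.lcoeff_apply, MvPolynomial.coeff_monomial, mul_ite, mul_one,
    mul_zero] at h
  exact h.tsum_eq.symm

theorem levelTrace_eq_zero {n : ℕ} {α : ℂ} {β s : Fin n → ℂ}
    (hs : s ∉ Set.range (exponents α β)) (N : ℕ) :
    levelTrace α N (List.ofFn fun i => vertexCoeff (β i) (s i)).prod = 0 := by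
  rw [levelTrace_eq_sum]
  refine Finset.sum_eq_zero fun μ _ => ?_
  rw [vertexCoeff_prod_single_eq_zero hs]
  rfl

/-! ### Logarithms of q-products -/

theorem hasSum_pow_div_pnat {t : ℂ} (ht : ‖t‖ < 1) :
    HasSum (fun m : ℕ+ => t ^ (m : ℕ) / ((m : ℕ) : ℂ)) (-Complex.log (1 - t)) := by
  have h := Complex.hasSum_taylorSeries_neg_log ht
  rw [← Function.Injective.hasSum_iff PNat.coe_injective] at h
  · exact h
  · intro n hn
    have : n = 0 := by
      by_contra h0
      exact hn ⟨⟨n, Nat.pos_of_ne_zero h0⟩, rfl⟩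
    simp [this]

theorem hasSum_pow_pnat {t : ℂ} (ht : ‖t‖ < 1) :
    HasSum (fun m : ℕ+ => t ^ (m : ℕ)) (t / (1 - t)) := by
  rw [← Equiv.pnatEquivNat.symm.hasSum_iff]
  convert! (hasSum_geometric_of_norm_lt_one ht).mul_left t using 1
  ext m
  simp [pow_succ']

/-- The series `∑_{m > 0} qᵐ / (1 - qᵐ) xᵐ / m`, convergent for `|q| < 1`, `|q x| < 1`. -/
def lambertLog (q x : ℂ) : ℂ :=
  ∑' m : ℕ+, q ^ (m : ℕ) / (1 - q ^ (m : ℕ)) * (x ^ (m : ℕ) / ((m : ℕ) : ℂ))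

theorem norm_pow_pnat_lt_one {q : ℂ} (hq : ‖q‖ < 1) (m : ℕ+) : ‖q ^ (m : ℕ)‖ < 1 := by
  rw [norm_pow]
  exact pow_lt_one₀ (norm_nonneg _) hq m.ne_zero

theorem norm_pow_mul_lt_one {q x : ℂ} (hq : ‖q‖ < 1) (hx : ‖q * x‖ < 1) (k : ℕ+) :
    ‖q ^ (k : ℕ) * x‖ < 1 := by
  obtain ⟨l, hl⟩ : ∃ l, (k : ℕ) = l + 1 := ⟨k - 1, by have := k.pos; omega⟩
  rw [hl, pow_succ, mul_assoc, norm_mul, norm_pow]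
  exact (mul_le_of_le_one_left (norm_nonneg _) (pow_le_one₀ (norm_nonneg _) hq.le)).trans_lt hx

theorem summable_lambert_double {q x : ℂ} (hq : ‖q‖ < 1) (hx : ‖q * x‖ < 1) :
    Summable fun p : ℕ+ × ℕ+ => (q ^ (p.1 : ℕ) * x) ^ (p.2 : ℕ) / ((p.2 : ℕ) : ℂ) := by
  have h1 : Summable fun k : ℕ+ => ‖q‖ ^ ((k : ℕ) - 1) := by
    rw [← Equiv.pnatEquivNat.symm.summable_iff]
    exact (summable_geometric_of_lt_one (norm_nonneg q) hq).congr fun k => by simp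
  have h2 : Summable fun m : ℕ+ => ‖q * x‖ ^ (m : ℕ) := by
    simpa only [norm_pow] using (hasSum_pow_pnat hx).summable.norm
  refine Summable.of_norm_bounded (h1.mul_of_nonneg h2 (fun _ => by positivity)
    fun _ => by positivity) fun p => ?_
  obtain ⟨k, m⟩ := p
  have hm : (1 : ℝ) ≤ (m : ℕ) := by exact_mod_cast m.pos
  obtain ⟨l, hl⟩ : ∃ l, (k : ℕ) = l + 1 := ⟨k - 1, by have := k.pos; omega⟩
  have h3 : (q ^ (k : ℕ) * x) ^ (m : ℕ) = (q ^ l) ^ (m : ℕ) * (q * x) ^ (m : ℕ) := by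
    rw [← mul_pow, hl]
    ring
  rw [h3, norm_div, Complex.norm_natCast, norm_mul, norm_pow, norm_pow, norm_pow, hl,
    Nat.add_sub_cancel]
  refine (div_le_self (by positivity) hm).trans ?_
  gcongr
  exact pow_le_of_le_one (by positivity) (pow_le_one₀ (norm_nonneg _) hq.le) m.ne_zero

theorem hasSum_lambertLog_double {q x : ℂ} (hq : ‖q‖ < 1) (hx : ‖q * x‖ < 1) :
    HasSum (fun m : ℕ+ => q ^ (m : ℕ) / (1 - q ^ (m : ℕ)) * (x ^ (m : ℕ) / ((m : ℕ) : ℂ)))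
      (lambertLog q x) ∧
    HasSum (fun p : ℕ+ × ℕ+ => (q ^ (p.1 : ℕ) * x) ^ (p.2 : ℕ) / ((p.2 : ℕ) : ℂ))
      (lambertLog q x) := by
  have hs := summable_lambert_double hq hx
  have h := ((Equiv.prodComm ℕ+ ℕ+).hasSum_iff.2 hs.hasSum).prod_fiberwise
    (g := fun m : ℕ+ => q ^ (m : ℕ) / (1 - q ^ (m : ℕ)) * (x ^ (m : ℕ) / ((m : ℕ) : ℂ)))
    fun m => by
      convert! (hasSum_pow_pnat (norm_pow_pnat_lt_one hq m)).mul_right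
        (x ^ (m : ℕ) / ((m : ℕ) : ℂ)) using 2 with k
      simp only [Function.comp_apply, Equiv.prodComm_apply, Prod.swap_prod_mk]
      rw [mul_pow, ← pow_mul, ← pow_mul, mul_comm (k : ℕ), mul_div_assoc]
  have h' : ∑' p : ℕ+ × ℕ+, (q ^ (p.1 : ℕ) * x) ^ (p.2 : ℕ) / ((p.2 : ℕ) : ℂ) =
      lambertLog q x := h.tsum_eq.symm
  exact ⟨h.summable.hasSum, h' ▸ hs.hasSum⟩

theorem hasSum_lambertLog {q x : ℂ} (hq : ‖q‖ < 1) (hx : ‖q * x‖ < 1) :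
    HasSum (fun m : ℕ+ => q ^ (m : ℕ) / (1 - q ^ (m : ℕ)) * (x ^ (m : ℕ) / ((m : ℕ) : ℂ)))
      (lambertLog q x) :=
  (hasSum_lambertLog_double hq hx).1

theorem hasSum_neg_log_one_sub {q x : ℂ} (hq : ‖q‖ < 1) (hx : ‖q * x‖ < 1) :
    HasSum (fun k : ℕ+ => -Complex.log (1 - q ^ (k : ℕ) * x)) (lambertLog q x) := by
  have h := (hasSum_lambertLog_double hq hx).2
  have h' : ∀ k : ℕ+, HasSum
      (fun m : ℕ+ => (q ^ (k : ℕ) * x) ^ (m : ℕ) / ((m : ℕ) : ℂ))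
      (-Complex.log (1 - q ^ (k : ℕ) * x)) :=
    fun k => hasSum_pow_div_pnat (norm_pow_mul_lt_one hq hx k)
  exact h.prod_fiberwise h'

theorem one_sub_ne_zero {t : ℂ} (ht : ‖t‖ < 1) : 1 - t ≠ 0 := by
  intro h
  rw [← sub_eq_zero.1 h, norm_one] at ht
  exact lt_irrefl _ ht

theorem hasProd_one_sub {q x : ℂ} (hq : ‖q‖ < 1) (hx : ‖q * x‖ < 1) :
    HasProd (fun k : ℕ+ => 1 - q ^ (k : ℕ) * x) (Complex.exp (-lambertLog q x)) := by
  convert! (hasSum_neg_log_one_sub hq hx).neg.cexp using 1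
  ext k
  rw [Function.comp_apply, neg_neg,
    Complex.exp_log (one_sub_ne_zero (norm_pow_mul_lt_one hq hx k))]

theorem hasProd_inv_one_sub {q : ℂ} (hq : ‖q‖ < 1) :
    HasProd (fun k : ℕ+ => (1 - q ^ (k : ℕ))⁻¹) (Complex.exp (lambertLog q 1)) := by
  convert! (hasSum_neg_log_one_sub hq (x := 1) (by simpa using hq)).cexp using 1
  ext k
  rw [Function.comp_apply, mul_one, Complex.exp_neg,
    Complex.exp_log (one_sub_ne_zero (norm_pow_pnat_lt_one hq k))]

/-! ### The product of the single-mode traces -/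

/-- The exponents of the normal ordered product, summed over all modes, when the `m`-th mode enters
through `aᵢ xᵢᵐ / m` and `bᵢ yᵢᵐ`. -/
theorem hasSum_modeExponent {n : ℕ} {q : ℂ} (hq : ‖q‖ < 1) (a b x y : Fin n → ℂ)
    (h1 : ∀ i j, i < j → ‖x j * y i‖ < 1) (h2 : ∀ i j, ‖q * (x i * y j)‖ < 1) :
    HasSum (fun m : ℕ+ =>
      (∑ p : Fin n × Fin n with p.1 < p.2,
        (b p.1 * y p.1 ^ (m : ℕ)) * (a p.2 / ((m : ℕ) : ℂ) * x p.2 ^ (m : ℕ))) +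
      (∑ i, a i / ((m : ℕ) : ℂ) * x i ^ (m : ℕ)) * (∑ i, b i * y i ^ (m : ℕ)) *
        (q ^ (m : ℕ) / (1 - q ^ (m : ℕ))))
      ((∑ p : Fin n × Fin n with p.1 < p.2,
        b p.1 * a p.2 * -Complex.log (1 - x p.2 * y p.1)) +
        ∑ i, ∑ j, a i * b j * lambertLog q (x i * y j)) := by
  refine HasSum.add (hasSum_sum fun p hp => ?_) ?_
  · convert! (hasSum_pow_div_pnat (h1 p.1 p.2 (Finset.mem_filter.1 hp).2)).mul_left
      (b p.1 * a p.2) using 2 with m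
    rw [mul_pow]
    ring
  · convert! hasSum_sum (s := Finset.univ) fun i _ => hasSum_sum (s := Finset.univ) fun j _ =>
      (hasSum_lambertLog hq (h2 i j)).mul_left (a i * b j) using 2 with m
    rw [Finset.sum_mul_sum, Finset.sum_mul]
    refine Finset.sum_congr rfl fun i _ => ?_
    rw [Finset.sum_mul]
    refine Finset.sum_congr rfl fun j _ => ?_
    rw [mul_pow]
    ring

theorem hasProd_modeTrace {n : ℕ} {q : ℂ} (hq : ‖q‖ < 1) (a b x y : Fin n → ℂ)
    (h1 : ∀ i j, i < j → ‖x j * y i‖ < 1) (h2 : ∀ i j, ‖q * (x i * y j)‖ < 1) :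
    HasProd (fun m : ℕ+ => modeTrace (q ^ (m : ℕ))
      (fun i => a i / ((m : ℕ) : ℂ) * x i ^ (m : ℕ)) (fun i => b i * y i ^ (m : ℕ)))
      (Complex.exp (lambertLog q 1) * Complex.exp ((∑ p : Fin n × Fin n with p.1 < p.2,
        b p.1 * a p.2 * -Complex.log (1 - x p.2 * y p.1)) +
        ∑ i, ∑ j, a i * b j * lambertLog q (x i * y j))) :=
  (hasProd_inv_one_sub hq).mul (hasSum_modeExponent hq a b x y h1 h2).cexp

theorem summable_inv_one_sub_mul_exp_sub_one {ι : Type*} {Q E : ι → ℂ} {r : ℝ} (hr : r < 1)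
    (hQ : ∀ m, ‖Q m‖ ≤ r) (hQs : Summable Q) (hE : Summable E) :
    Summable fun m => (1 - Q m)⁻¹ * Complex.exp (E m) - 1 := by
  have h1 : (fun m => Complex.exp (E m) - 1) =O[Filter.cofinite] E := by
    have h := (Complex.hasDerivAt_exp 0).isBigO_sub.comp_tendsto hE.tendsto_cofinite_zero
    simpa [Function.comp_def] using h
  have h2 : Summable fun m => Complex.exp (E m) - 1 := summable_of_isBigO hE.norm h1.norm_right
  have h3 : Summable fun m => (Complex.exp (E m) - 1) + Q m := h2.add hQs
  refine Summable.of_norm_bounded (h3.norm.mul_left (1 - r)⁻¹) fun m => ?_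
  have hm : 1 - Q m ≠ 0 := one_sub_ne_zero ((hQ m).trans_lt hr)
  have h4 : (1 - Q m)⁻¹ * Complex.exp (E m) - 1 =
      (1 - Q m)⁻¹ * ((Complex.exp (E m) - 1) + Q m) := by
    field_simp
    ring
  rw [h4, norm_mul, norm_inv]
  gcongr
  have := norm_sub_norm_le (1 : ℂ) (Q m)
  rw [norm_one] at this
  linarith [hQ m]

theorem modeTerm_zero {n : ℕ} (Q : ℂ) (A B : Fin n → ℂ) : modeTerm Q A B 0 = 1 := by
  have h : ∀ (n : ℕ) (A B : Fin n → ℂ),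
      pathEnd (fun _ : Fin n => ((0 : ℕ), (0 : ℕ))) 0 = 0 ∧
        pathWt A B (fun _ : Fin n => ((0 : ℕ), (0 : ℕ))) 0 = 1 := by
    intro n
    induction n with
    | zero => exact fun _ _ => ⟨rfl, rfl⟩
    | succ n ih =>
      intro A B
      have h := ih (Fin.tail A) (Fin.tail B)
      have ht : Fin.tail (fun _ : Fin (n + 1) => ((0 : ℕ), (0 : ℕ))) = fun _ => (0, 0) := rfl
      refine ⟨by simp [pathEnd, ht, h.1], by rw [pathWt, ht, h.1, h.2]; simp [stepWt]⟩
  have h' := h n A B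
  change Q ^ 0 * (if pathEnd (fun _ : Fin n => ((0 : ℕ), (0 : ℕ))) 0 = 0 then
    pathWt A B (fun _ : Fin n => ((0 : ℕ), (0 : ℕ))) 0 else 0) = 1
  rw [if_pos h'.1, h'.2, pow_zero, one_mul]

/-- The trace over the full Fock space is the product of the traces over the single modes. -/
theorem hasSum_prod_modeTerm {n : ℕ} {q : ℂ} (hq : ‖q‖ < 1) (a b x y : Fin n → ℂ)
    (h1 : ∀ i j, i < j → ‖x j * y i‖ < 1) (h2 : ∀ i j, ‖q * (x i * y j)‖ < 1) :
    HasSum (fun ξ : ℕ+ →₀ ℕ × (Fin n → ℕ × ℕ) => ξ.prod fun m => modeTerm (q ^ (m : ℕ))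
      (fun i => a i / ((m : ℕ) : ℂ) * x i ^ (m : ℕ)) (fun i => b i * y i ^ (m : ℕ)))
      (Complex.exp (lambertLog q 1) * Complex.exp ((∑ p : Fin n × Fin n with p.1 < p.2,
        b p.1 * a p.2 * -Complex.log (1 - x p.2 * y p.1)) +
        ∑ i, ∑ j, a i * b j * lambertLog q (x i * y j))) := by
  refine hasSum_finsupp_prod (fun m => modeTerm_zero _ _ _)
    (fun m => hasSum_modeTerm (norm_pow_pnat_lt_one hq m) _ _) ?_
    (hasProd_modeTrace hq a b x y h1 h2)
  -- The sums of norms are the single-mode traces for the absolute values of the parameters.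
  have hq' : ‖((‖q‖ : ℝ) : ℂ)‖ < 1 := by simpa using hq
  have hE := (hasSum_modeExponent hq' (fun i => ((‖a i‖ : ℝ) : ℂ)) (fun i => ((‖b i‖ : ℝ) : ℂ))
    (fun i => ((‖x i‖ : ℝ) : ℂ)) (fun i => ((‖y i‖ : ℝ) : ℂ))
    (fun i j hij => by simpa using h1 i j hij) (fun i j => by simpa using h2 i j)).summable
  have hS := summable_inv_one_sub_mul_exp_sub_one (r := ‖q‖) hq
    (Q := fun m : ℕ+ => ((‖q‖ : ℝ) : ℂ) ^ (m : ℕ)) (fun m => by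
      rw [norm_pow, Complex.norm_real, norm_norm]
      exact pow_le_of_le_one (norm_nonneg _) hq.le m.ne_zero) (hasSum_pow_pnat hq').summable hE
  refine Complex.summable_ofReal.1 (hS.congr fun m => ?_)
  rw [Complex.ofReal_sub, Complex.ofReal_one, Complex.ofReal_tsum]
  simp only [norm_modeTerm]
  rw [(hasSum_modeTerm (by simpa using norm_pow_pnat_lt_one hq m) _ _).tsum_eq, modeTrace]
  simp

/-! ### Factorization over the modes -/

/-- The components at the mode `m` of a family of pairs of exponents. -/
def atMode {n : ℕ} (S : Fin n → (ℕ+ →₀ ℕ) × (ℕ+ →₀ ℕ)) (m : ℕ+) (i : Fin n) : ℕ × ℕ :=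
  ((S i).1 m, (S i).2 m)

theorem pathEnd_apply {n : ℕ} (S : Fin n → (ℕ+ →₀ ℕ) × (ℕ+ →₀ ℕ)) (μ : ℕ+ →₀ ℕ) (m : ℕ+) :
    pathEnd S μ m = pathEnd (atMode S m) (μ m) := by
  induction n with
  | zero => rfl
  | succ n ih =>
    rw [pathEnd, pathEnd, Finsupp.add_apply, Finsupp.tsub_apply, ih]
    rfl

theorem multiStepWt_eq_prod (a b : ℕ+ → ℂ) (p : (ℕ+ →₀ ℕ) × (ℕ+ →₀ ℕ)) (ν : ℕ+ →₀ ℕ)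
    {T : Finset ℕ+} (h1 : p.1.support ⊆ T) (h2 : p.2.support ⊆ T) :
    multiStepWt a b p ν = ∏ m ∈ T, stepWt (a m) (b m) (p.1 m, p.2 m) (ν m) := by
  rw [multiStepWt, creationWt, annihilationWt,
    Finsupp.prod_of_support_subset _ h1 _ fun m _ => by simp,
    Finsupp.prod_of_support_subset _ h2 _ fun m _ => by simp, ← Finset.prod_mul_distrib]
  rfl

theorem multiPathWt_eq_prod {n : ℕ} (a b : Fin n → ℕ+ → ℂ)
    (S : Fin n → (ℕ+ →₀ ℕ) × (ℕ+ →₀ ℕ)) (μ : ℕ+ →₀ ℕ) {T : Finset ℕ+}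
    (h1 : ∀ i, (S i).1.support ⊆ T) (h2 : ∀ i, (S i).2.support ⊆ T) :
    multiPathWt a b S μ =
      ∏ m ∈ T, pathWt (fun i => a i m) (fun i => b i m) (atMode S m) (μ m) := by
  induction n with
  | zero => simp [multiPathWt, pathWt]
  | succ n ih =>
    rw [multiPathWt, ih _ _ (Fin.tail S) (fun i => h1 i.succ) (fun i => h2 i.succ),
      multiStepWt_eq_prod _ _ _ _ (h1 0) (h2 0), ← Finset.prod_mul_distrib]
    refine Finset.prod_congr rfl fun m _ => ?_
    rw [pathEnd_apply, pathWt]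
    rfl

theorem pathWt_mul {n : ℕ} (A B c d : Fin n → ℂ) (s : Fin n → ℕ × ℕ) (μ : ℕ) :
    pathWt (fun i => A i * c i) (fun i => B i * d i) s μ =
      pathWt A B s μ * ∏ i, c i ^ (s i).1 * d i ^ (s i).2 := by
  induction n with
  | zero => simp [pathWt]
  | succ n ih =>
    have h1 : Fin.tail (fun i => A i * c i) = fun i => Fin.tail A i * Fin.tail c i := rfl
    have h2 : Fin.tail (fun i => B i * d i) = fun i => Fin.tail B i * Fin.tail d i := rfl
    rw [pathWt, h1, h2, ih, pathWt, Fin.prod_univ_succ, stepWt, stepWt, mul_pow, mul_pow]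
    simp only [Fin.tail]
    ring

theorem pow_weight {w : ℂ} {lam : ℕ+ →₀ ℕ} {T : Finset ℕ+} (h : lam.support ⊆ T) :
    w ^ Finsupp.weight wt lam = ∏ m ∈ T, (w ^ (m : ℕ)) ^ lam m := by
  rw [Finsupp.weight_apply, Finsupp.sum_of_support_subset _ h _ fun m _ => by simp,
    ← Finset.prod_pow_eq_pow_sum]
  refine Finset.prod_congr rfl fun m _ => ?_
  rw [← pow_mul, smul_eq_mul, wt, mul_comm]

theorem zpow_degShift {w : ℂ} (hw : w ≠ 0) (p : (ℕ+ →₀ ℕ) × (ℕ+ →₀ ℕ)) {T : Finset ℕ+}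
    (h1 : p.1.support ⊆ T) (h2 : p.2.support ⊆ T) :
    w ^ degShift p = ∏ m ∈ T, (w ^ (m : ℕ)) ^ p.1 m * (w⁻¹ ^ (m : ℕ)) ^ p.2 m := by
  rw [Finset.prod_mul_distrib, ← pow_weight h1, ← pow_weight h2, degShift, zpow_sub₀ hw,
    zpow_natCast, zpow_natCast, inv_pow, div_eq_mul_inv]

/-- A starting exponent together with a family of pairs of exponents, all of them indexed by the
modes, amounts to such data for each single mode. -/
def modeEquiv (n : ℕ) : (ℕ+ →₀ ℕ) × (Fin n → (ℕ+ →₀ ℕ) × (ℕ+ →₀ ℕ)) ≃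
    (ℕ+ →₀ ℕ × (Fin n → ℕ × ℕ)) where
  toFun t := Finsupp.onFinset
    (t.1.support ∪ Finset.univ.biUnion fun i => (t.2 i).1.support ∪ (t.2 i).2.support)
    (fun m => (t.1 m, atMode t.2 m)) fun m hm => by
      by_contra h
      refine hm ?_
      simp only [Finset.mem_union, Finset.mem_biUnion, Finset.mem_univ, true_and,
        Finsupp.mem_support_iff, not_or, not_exists, not_not] at h
      refine Prod.ext h.1 (funext fun i => Prod.ext (h.2 i).1 (h.2 i).2)
  invFun ξ := (ξ.mapRange Prod.fst rfl, fun i =>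
    (ξ.mapRange (fun x => (x.2 i).1) rfl, ξ.mapRange (fun x => (x.2 i).2) rfl))
  left_inv t := by
    refine Prod.ext ?_ (funext fun i => Prod.ext ?_ ?_) <;> ext m <;> simp [atMode]
  right_inv ξ := by
    ext m
    · rfl
    · rfl
    · rfl

theorem modeEquiv_apply {n : ℕ} (t : (ℕ+ →₀ ℕ) × (Fin n → (ℕ+ →₀ ℕ) × (ℕ+ →₀ ℕ))) (m : ℕ+) :
    modeEquiv n t m = (t.1 m, atMode t.2 m) := rfl

/-- The contribution to the trace of the monomial `x^μ`, `μ = t.1`, and of the family of terms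
`t.2` of the exponentials. -/
def traceTerm {n : ℕ} (q : ℂ) (β w : Fin n → ℂ)
    (t : (ℕ+ →₀ ℕ) × (Fin n → (ℕ+ →₀ ℕ) × (ℕ+ →₀ ℕ))) : ℂ :=
  q ^ Finsupp.weight wt t.1 * (∏ i, w i ^ degShift (t.2 i)) *
    if pathEnd t.2 t.1 = t.1 then
      multiPathWt (fun i m => β i / (m : ℂ)) (fun i _ => -β i) t.2 t.1 else 0

theorem traceTerm_eq_prod {n : ℕ} (q : ℂ) (β : Fin n → ℂ) {w : Fin n → ℂ} (hw : ∀ i, w i ≠ 0)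
    (t : (ℕ+ →₀ ℕ) × (Fin n → (ℕ+ →₀ ℕ) × (ℕ+ →₀ ℕ))) :
    traceTerm q β w t = (modeEquiv n t).prod fun m => modeTerm (q ^ (m : ℕ))
      (fun i => β i / ((m : ℕ) : ℂ) * w i ^ (m : ℕ)) (fun i => -β i * (w i)⁻¹ ^ (m : ℕ)) := by
  classical
  obtain ⟨μ, S⟩ := t
  set T := μ.support ∪ Finset.univ.biUnion fun i => (S i).1.support ∪ (S i).2.support with hT
  have hμ : μ.support ⊆ T := Finset.subset_union_left
  have h12 : ∀ i, (S i).1.support ∪ (S i).2.support ⊆ T := fun i =>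
    (Finset.subset_biUnion_of_mem (fun i => (S i).1.support ∪ (S i).2.support)
      (Finset.mem_univ i)).trans Finset.subset_union_right
  have h1 : ∀ i, (S i).1.support ⊆ T := fun i => Finset.subset_union_left.trans (h12 i)
  have h2 : ∀ i, (S i).2.support ⊆ T := fun i => Finset.subset_union_right.trans (h12 i)
  have hprod : ∏ i, w i ^ degShift (S i) = ∏ m ∈ T, ∏ i,
      (w i ^ (m : ℕ)) ^ (S i).1 m * ((w i)⁻¹ ^ (m : ℕ)) ^ (S i).2 m := by
    rw [Finset.prod_comm]
    exact Finset.prod_congr rfl fun i _ => zpow_degShift (hw i) _ (h1 i) (h2 i)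
  have hmem : ∀ m, m ∉ T → pathEnd S μ m = μ m := by
    intro m hm
    have hz : ∀ i, (S i).1 m = 0 ∧ (S i).2 m = 0 := fun i =>
      ⟨Finsupp.notMem_support_iff.1 fun h => hm (h1 i h),
        Finsupp.notMem_support_iff.1 fun h => hm (h2 i h)⟩
    clear_value T
    clear hT hμ h12 h1 h2 hprod hw
    induction n with
    | zero => rfl
    | succ n ih =>
      rw [pathEnd, Finsupp.add_apply, Finsupp.tsub_apply, (hz 0).1, (hz 0).2,
        ih (Fin.tail β) (w := Fin.tail w) (Fin.tail S) fun i => hz i.succ]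
      rfl
  have hend : pathEnd S μ = μ ↔ ∀ m ∈ T, pathEnd (atMode S m) (μ m) = μ m := by
    simp only [← pathEnd_apply]
    refine ⟨fun h m _ => by rw [h], fun h => Finsupp.ext fun m => ?_⟩
    by_cases hm : m ∈ T
    exacts [h m hm, hmem m hm]
  have hsupp : (modeEquiv n (μ, S)).support ⊆ T := by
    simp only [modeEquiv, Equiv.coe_fn_mk]
    exact Finsupp.support_onFinset_subset
  rw [Finsupp.prod_of_support_subset _ hsupp _ fun m _ => modeTerm_zero _ _ _]
  simp only [modeEquiv_apply, modeTerm, traceTerm, pathWt_mul]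
  by_cases h : pathEnd S μ = μ
  · rw [if_pos h, pow_weight hμ, hprod, multiPathWt_eq_prod _ _ _ _ h1 h2,
      ← Finset.prod_mul_distrib, ← Finset.prod_mul_distrib]
    refine Finset.prod_congr rfl fun m hm => ?_
    rw [if_pos (hend.1 h m hm), mul_assoc]
    congr 1
    exact mul_comm _ _
  · rw [if_neg h, mul_zero]
    obtain ⟨m, hm, hne⟩ : ∃ m ∈ T, pathEnd (atMode S m) (μ m) ≠ μ m := by
      by_contra! h'
      exact h (hend.2 h')
    exact (Finset.prod_eq_zero hm (by rw [if_neg hne, mul_zero])).symm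

theorem hasSum_traceTerm {n : ℕ} {q : ℂ} (hq : ‖q‖ < 1) (β : Fin n → ℂ) {w : Fin n → ℂ}
    (hw : ∀ i, w i ≠ 0) (h1 : ∀ i j, i < j → ‖w j / w i‖ < 1)
    (h2 : ∀ i j, ‖q * (w i / w j)‖ < 1) :
    HasSum (traceTerm q β w) (Complex.exp (lambertLog q 1) * Complex.exp
      ((∑ p : Fin n × Fin n with p.1 < p.2,
        -β p.1 * β p.2 * -Complex.log (1 - w p.2 / w p.1)) +
        ∑ i, ∑ j, β i * -β j * lambertLog q (w i / w j))) := by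
  have h := hasSum_prod_modeTerm hq β (fun i => -β i) w (fun i => (w i)⁻¹)
    (by simpa only [div_eq_mul_inv] using h1) (by simpa only [div_eq_mul_inv] using h2)
  rw [← (modeEquiv n).hasSum_iff] at h
  simp only [div_eq_mul_inv (w _)]
  convert! h using 1
  ext t
  exact traceTerm_eq_prod q β hw t

/-! ### The terms of the `n`-point function -/

/-- The `(N, s)`-term of the `n`-point function collects the contributions to the trace with given
degree and given exponents. -/
theorem nPointTerm_eq_tsum {n : ℕ} (τ : ℍ) (α : ℂ) {β : Fin n → ℂ} (hβ : ∑ i, β i = 0)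
    (z : Fin n → ℂ)
    (hs : Summable (traceTerm (Complex.exp (2 * Real.pi * Complex.I * (τ : ℂ))) β
      fun i => Complex.exp (z i))) (p : ℕ × (Fin n → ℂ)) :
    nPointTerm τ α β z p =
      (∏ i, Complex.exp (β i ^ 2 / 2 * z i) * Complex.exp (exponents α β 0 i * z i)) *
        Complex.exp (2 * Real.pi * Complex.I * (τ : ℂ) * (α ^ 2 / 2 - 1 / 24)) *
      ∑' t : (fun t : (ℕ+ →₀ ℕ) × (Fin n → (ℕ+ →₀ ℕ) × (ℕ+ →₀ ℕ)) =>
          (Finsupp.weight wt t.1, exponents α β fun i => degShift (t.2 i))) ⁻¹' {p},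
        traceTerm (Complex.exp (2 * Real.pi * Complex.I * (τ : ℂ))) β
          (fun i => Complex.exp (z i)) t := by
  obtain ⟨N, s⟩ := p
  set q := Complex.exp (2 * Real.pi * Complex.I * (τ : ℂ)) with hq
  by_cases h : s ∈ Set.range (exponents α β)
  swap
  · rw [nPointTerm, levelTrace_eq_zero h, zero_mul, zero_mul]
    have : IsEmpty ((fun t : (ℕ+ →₀ ℕ) × (Fin n → (ℕ+ →₀ ℕ) × (ℕ+ →₀ ℕ)) =>
          (Finsupp.weight wt t.1, exponents α β fun i => degShift (t.2 i))) ⁻¹' {(N, s)}) :=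
      ⟨fun t => h ⟨_, congrArg Prod.snd t.2⟩⟩
    rw [tsum_empty, mul_zero]
  obtain ⟨k, rfl⟩ := h
  rw [tsum_subtype _ (traceTerm q β fun i => Complex.exp (z i)),
    (hs.indicator _).tsum_prod]
  have hfib : ∀ (μ : ℕ+ →₀ ℕ), (∑' S, Set.indicator
      ((fun t : (ℕ+ →₀ ℕ) × (Fin n → (ℕ+ →₀ ℕ) × (ℕ+ →₀ ℕ)) =>
          (Finsupp.weight wt t.1, exponents α β fun i => degShift (t.2 i))) ⁻¹'
        {(N, exponents α β k)}) (traceTerm q β fun i => Complex.exp (z i)) (μ, S)) =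
      if μ ∈ wtFinset N then q ^ N * (∏ i, Complex.exp (z i) ^ k i) *
        ∑' S, if pathEnd S μ = μ then oscPathWt β k S μ else 0 else 0 := by
    intro μ
    split_ifs with hμ <;> rw [mem_wtFinset] at hμ
    · rw [← tsum_mul_left]
      refine tsum_congr fun S => ?_
      by_cases hS : ∀ i, degShift (S i) = k i
      · have hS' : (fun i => degShift (S i)) = k := funext hS
        rw [Set.indicator_of_mem (by simp [hμ, hS']), traceTerm, oscPathWt, if_pos hS]
        simp only [hμ, hS]
      · rw [Set.indicator_of_notMem, oscPathWt, if_neg hS]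
        · simp
        · intro h
          exact hS (congrFun (exponents_injective α β (congrArg Prod.snd h)))
    · refine (tsum_congr fun S => Set.indicator_of_notMem ?_ _).trans tsum_zero
      intro h
      exact hμ (congrArg Prod.fst h)
  simp only [hfib]
  rw [tsum_eq_sum (s := wtFinset N) (fun μ hμ => if_neg hμ), Finset.sum_ite_mem,
    Finset.inter_self, ← Finset.mul_sum, nPointTerm, levelTrace_exponents α hβ]
  have hz : ∀ i, Complex.exp (exponents α β k i * z i) =
      Complex.exp (exponents α β 0 i * z i) * Complex.exp (z i) ^ k i := by
    intro i
    rw [← Complex.exp_int_mul, ← Complex.exp_add]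
    congr 1
    simp only [exponents, Pi.zero_apply, Int.cast_zero]
    ring
  have hN : Complex.exp (2 * Real.pi * Complex.I * (τ : ℂ) * (α ^ 2 / 2 + (N : ℂ) - 1 / 24)) =
      Complex.exp (2 * Real.pi * Complex.I * (τ : ℂ) * (α ^ 2 / 2 - 1 / 24)) * q ^ N := by
    rw [hq, ← Complex.exp_nat_mul, ← Complex.exp_add]
    congr 1
    ring
  simp only [hz, hN, Finset.prod_mul_distrib]
  ring

/-! ### The Jacobi triple product -/

/-- The finite product `(1 - q) ⋯ (1 - qᴺ)`. -/
def qFactorial (q : ℂ) (N : ℕ) : ℂ := ∏ k ∈ Finset.range N, (1 - q ^ (k + 1))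

/-- The reciprocal of `(1 - q) ⋯ (1 - qᵏ)`, extended by zero to negative integers `k`; this makes
the recursion `invQFactorial_sub_one` hold for all integers. -/
def invQFactorial (q : ℂ) (k : ℤ) : ℂ := if 0 ≤ k then (qFactorial q k.toNat)⁻¹ else 0

theorem one_sub_pow_ne_zero {q : ℂ} (hq : ‖q‖ < 1) (k : ℕ) : 1 - q ^ (k + 1) ≠ 0 :=
  one_sub_ne_zero (norm_pow_pnat_lt_one hq k.succPNat)

theorem invQFactorial_sub_one {q : ℂ} (hq : ‖q‖ < 1) (k : ℤ) :
    invQFactorial q (k - 1) = (1 - q ^ k) * invQFactorial q k := by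
  rcases lt_trichotomy k 0 with h | rfl | h
  · rw [invQFactorial, if_neg (by omega), invQFactorial, if_neg (by omega), mul_zero]
  · simp [invQFactorial]
  · obtain ⟨l, rfl⟩ : ∃ l : ℕ, k = (l : ℤ) + 1 := ⟨(k - 1).toNat, by omega⟩
    have h1 : ((l : ℤ) + 1).toNat = l + 1 := by omega
    rw [invQFactorial, if_pos (by omega), invQFactorial, if_pos (by omega), h1,
      add_sub_cancel_right, Int.toNat_natCast, qFactorial, qFactorial, Finset.prod_range_succ,
      mul_inv, show q ^ ((l : ℤ) + 1) = q ^ (l + 1) by exact_mod_cast zpow_natCast q (l + 1)]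
    have h2 := one_sub_pow_ne_zero hq l
    field_simp

/-- A finite form of the Jacobi triple product; the series `t` stands for
`(-1)ᵐ q^{m (m + 1) / 2} xᵐ` up to a common factor. -/
theorem hasSum_finite_triple_product {q x : ℂ} (hq : ‖q‖ < 1) (hq0 : q ≠ 0) (hx : x ≠ 0)
    {t : ℤ → ℂ} (ht : ∀ m, t m = -q ^ m * x * t (m - 1)) (N : ℕ) :
    HasSum (fun m : ℤ => qFactorial q (2 * N) * invQFactorial q (N + m) *
      invQFactorial q (N - m) * t m)
      (t 0 * ∏ k ∈ Finset.range N, (1 - q ^ (k + 1) * x) * (1 - q ^ k * x⁻¹)) := by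
  induction N with
  | zero =>
    have h := hasSum_single (f := fun m : ℤ => qFactorial q (2 * 0) *
      invQFactorial q ((0 : ℕ) + m) * invQFactorial q ((0 : ℕ) - m) * t m) 0 fun m hm => by
        rcases lt_or_gt_of_ne hm with h | h
        · rw [invQFactorial, if_neg (by omega)]
          simp
        · rw [invQFactorial, invQFactorial, if_neg (c := 0 ≤ ((0 : ℕ) : ℤ) - m) (by omega)]
          simp
    convert! h using 1
    simp [invQFactorial, qFactorial]
  | succ N ih =>
    have h1 := ih.mul_left (1 + q ^ (2 * N + 1))
    have h2 := (Equiv.subRight (1 : ℤ)).hasSum_iff.2 (ih.mul_left (-q ^ (N + 1) * x))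
    have h3 := (Equiv.addRight (1 : ℤ)).hasSum_iff.2 (ih.mul_left (-q ^ N * x⁻¹))
    convert! (h1.add h2).add h3 using 1
    · ext m
      simp only [Function.comp_apply, Equiv.subRight_apply, Equiv.coe_addRight]
      have e1 : invQFactorial q (N + m) =
          (1 - q ^ ((N : ℤ) + m) * q) * invQFactorial q ((N + 1 : ℕ) + m) := by
        rw [← zpow_add_one₀ hq0, show (N : ℤ) + m + 1 = (N + 1 : ℕ) + m by push_cast; ring,
          ← invQFactorial_sub_one hq]
        congr 1
        push_cast
        ring
      have e2 : invQFactorial q (N - m) =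
          (1 - q ^ ((N : ℤ) - m) * q) * invQFactorial q ((N + 1 : ℕ) - m) := by
        rw [← zpow_add_one₀ hq0, show (N : ℤ) - m + 1 = (N + 1 : ℕ) - m by push_cast; ring,
          ← invQFactorial_sub_one hq]
        congr 1
        push_cast
        ring
      have e3 : invQFactorial q (N + (m - 1)) =
          (1 - q ^ ((N : ℤ) + m)) * invQFactorial q (N + m) := by
        rw [← invQFactorial_sub_one hq, add_sub_assoc]
      have e4 : invQFactorial q (N - (m + 1)) =
          (1 - q ^ ((N : ℤ) - m)) * invQFactorial q (N - m) := by
        rw [← invQFactorial_sub_one hq, sub_sub]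
      have e5 : invQFactorial q (N - (m - 1)) = invQFactorial q ((N + 1 : ℕ) - m) := by
        congr 1
        push_cast
        ring
      have e6 : invQFactorial q (N + (m + 1)) = invQFactorial q ((N + 1 : ℕ) + m) := by
        congr 1
        push_cast
        ring
      have e7 : q ^ (2 * N) = q ^ ((N : ℤ) + m) * q ^ ((N : ℤ) - m) := by
        rw [← zpow_add₀ hq0, ← zpow_natCast]
        congr 1
        push_cast
        ring
      have e8 : qFactorial q (2 * (N + 1)) =
          qFactorial q (2 * N) * (1 - q ^ (2 * N) * q) * (1 - q ^ (2 * N) * q ^ 2) := by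
        rw [show 2 * (N + 1) = 2 * N + 1 + 1 by ring, qFactorial, Finset.prod_range_succ,
          Finset.prod_range_succ, qFactorial]
        ring
      have e9 : -q ^ (N + 1) * x * t (m - 1) = q ^ ((N : ℤ) - m) * q * t m := by
        rw [ht m, zpow_sub₀ hq0, zpow_natCast]
        have := zpow_ne_zero m hq0
        field_simp
        ring
      have e10 : -q ^ N * x⁻¹ * t (m + 1) = q ^ ((N : ℤ) + m) * q * t m := by
        rw [ht (m + 1), add_sub_cancel_right, zpow_add₀ hq0, zpow_add₀ hq0, zpow_natCast,
          zpow_one]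
        field_simp
      rw [e3, e4, e5, e6, e1, e2, e8, pow_succ q (2 * N), e7]
      generalize q ^ ((N : ℤ) + m) = U at *
      generalize q ^ ((N : ℤ) - m) = V at *
      generalize invQFactorial q ((N + 1 : ℕ) + m) = a at *
      generalize invQFactorial q ((N + 1 : ℕ) - m) = b at *
      linear_combination -(qFactorial q (2 * N) * ((1 - U) * ((1 - U * q) * a)) * b) * e9 -
        (qFactorial q (2 * N) * a * ((1 - V) * ((1 - V * q) * b))) * e10
    · rw [Finset.prod_range_succ]
      have : q ^ (2 * N + 1) = q ^ (N + 1) * q ^ N := by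
        rw [← pow_add]
        congr 1
        ring
      rw [this]
      generalize ∏ k ∈ Finset.range N, (1 - q ^ (k + 1) * x) * (1 - q ^ k * x⁻¹) = P
      field_simp
      ring

theorem tendsto_prod_range_one_sub {q x : ℂ} (hq : ‖q‖ < 1) (hx : ‖q * x‖ < 1) :
    Filter.Tendsto (fun N => ∏ k ∈ Finset.range N, (1 - q ^ (k + 1) * x)) Filter.atTop
      (𝓝 (Complex.exp (-lambertLog q x))) := by
  have h := (Equiv.pnatEquivNat.symm.hasProd_iff (f := fun k : ℕ+ => 1 - q ^ (k : ℕ) * x)).2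
    (hasProd_one_sub hq hx)
  exact h.tendsto_prod_nat

theorem tendsto_qFactorial {q : ℂ} (hq : ‖q‖ < 1) :
    Filter.Tendsto (qFactorial q) Filter.atTop (𝓝 (Complex.exp (-lambertLog q 1))) := by
  have h := tendsto_prod_range_one_sub hq (x := 1) (by simpa using hq)
  simp only [mul_one] at h
  exact h

theorem tendsto_invQFactorial {q : ℂ} (hq : ‖q‖ < 1) :
    Filter.Tendsto (invQFactorial q) Filter.atTop (𝓝 (Complex.exp (-lambertLog q 1))⁻¹) := by
  have hnat : Filter.Tendsto Int.toNat Filter.atTop Filter.atTop :=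
    Filter.tendsto_atTop.2 fun b => by
      filter_upwards [Filter.eventually_ge_atTop (b : ℤ)] with k hk
      omega
  have h := ((tendsto_qFactorial hq).inv₀ (Complex.exp_ne_zero _)).comp hnat
  refine h.congr' ?_
  filter_upwards [Filter.eventually_ge_atTop (0 : ℤ)] with k hk
  rw [invQFactorial, if_pos hk]
  rfl

theorem exists_norm_invQFactorial_le {q : ℂ} (hq : ‖q‖ < 1) :
    ∃ C, ∀ k, ‖invQFactorial q k‖ ≤ C := by
  obtain ⟨C, hC⟩ := ((tendsto_qFactorial hq).inv₀ (Complex.exp_ne_zero _)).norm.bddAbove_range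
  refine ⟨C, fun k => ?_⟩
  rw [invQFactorial]
  split_ifs
  · exact hC ⟨_, rfl⟩
  · rw [norm_zero]
    exact (norm_nonneg _).trans (hC ⟨0, rfl⟩)

/-- The Jacobi triple product, with the infinite products in exponential form. -/
theorem tsum_eq_triple_product {q x : ℂ} (hq : ‖q‖ < 1) (hq0 : q ≠ 0) (hx : x ≠ 0)
    (h1 : ‖q * x‖ < 1) (h2 : ‖q * x⁻¹‖ < 1) {t : ℤ → ℂ} (hts : Summable t)
    (ht : ∀ m, t m = -q ^ m * x * t (m - 1)) :
    ∑' m, t m = t 0 * (1 - x⁻¹) * (Complex.exp (-lambertLog q 1) *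
      (Complex.exp (-lambertLog q x) * Complex.exp (-lambertLog q x⁻¹))) := by
  set c := Complex.exp (-lambertLog q 1) with hc
  have hc0 : c ≠ 0 := Complex.exp_ne_zero _
  obtain ⟨C, hC⟩ := exists_norm_invQFactorial_le hq
  obtain ⟨D, hD⟩ := (tendsto_qFactorial hq).norm.bddAbove_range
  have hlim1 : Filter.Tendsto (fun N : ℕ => ∑' m : ℤ, qFactorial q (2 * N) *
      invQFactorial q (N + m) * invQFactorial q (N - m) * t m) Filter.atTop
      (𝓝 (∑' m : ℤ, c⁻¹ * t m)) := by
    refine tendsto_tsum_of_dominated_convergence (hts.norm.mul_left (D * C * C)) (fun m => ?_)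
      (Filter.Eventually.of_forall fun N m => ?_)
    · have hN : Filter.Tendsto (fun N : ℕ => 2 * N) Filter.atTop Filter.atTop :=
        Filter.tendsto_id.const_mul_atTop' two_pos
      have e1 := (tendsto_qFactorial hq).comp hN
      have e2 := (tendsto_invQFactorial hq).comp
        (Filter.tendsto_atTop_add_const_right _ m tendsto_natCast_atTop_atTop)
      have e3 := (tendsto_invQFactorial hq).comp
        (Filter.tendsto_atTop_add_const_right _ (-m) tendsto_natCast_atTop_atTop)
      have e4 := ((e1.mul e2).mul e3).mul_const (t m)
      rw [← hc, mul_inv_cancel₀ hc0, one_mul] at e4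
      exact e4
    · rw [norm_mul, norm_mul, norm_mul]
      have hC0 : 0 ≤ C := (norm_nonneg _).trans (hC 0)
      have hD0 : 0 ≤ D := (norm_nonneg _).trans (hD ⟨0, rfl⟩)
      have hD1 : ‖qFactorial q (2 * N)‖ ≤ D := hD ⟨_, rfl⟩
      gcongr
      exacts [hC _, hC _]
  have hlim2 : Filter.Tendsto (fun N : ℕ =>
      t 0 * ∏ k ∈ Finset.range (N + 1), (1 - q ^ (k + 1) * x) * (1 - q ^ k * x⁻¹)) Filter.atTop
      (𝓝 (t 0 * (Complex.exp (-lambertLog q x) *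
        (Complex.exp (-lambertLog q x⁻¹) * (1 - x⁻¹))))) := by
    have e1 := (tendsto_prod_range_one_sub hq h1).comp (Filter.tendsto_add_atTop_nat 1)
    have e2 := (tendsto_prod_range_one_sub hq h2).mul_const (1 - x⁻¹)
    refine ((e1.mul e2).const_mul (t 0)).congr fun N => ?_
    rw [Finset.prod_mul_distrib, Finset.prod_range_succ' (fun k => 1 - q ^ k * x⁻¹), pow_zero,
      one_mul]
    rfl
  have hlim3 := hlim1.comp (Filter.tendsto_add_atTop_nat 1)
  have h := tendsto_nhds_unique hlim3 (hlim2.congr fun N =>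
    (hasSum_finite_triple_product hq hq0 hx ht (N + 1)).tsum_eq.symm)
  rw [tsum_mul_left] at h
  rw [← mul_inv_cancel_left₀ hc0 (∑' m, t m), h]
  ring

/-! ### The prime form -/

/-- The terms of the series defining `ϑ₁`. -/
def theta1Term (z τ : ℂ) (m : ℤ) : ℂ :=
  Complex.exp (Complex.I * Real.pi * ((m : ℂ) + (1 / 2 : ℝ)) ^ 2 * τ +
    ((m : ℂ) + (1 / 2 : ℝ)) * (z + 2 * Real.pi * Complex.I * (1 / 2 : ℝ)))

theorem summable_theta1Term (z : ℂ) (τ : ℍ) : Summable (theta1Term z τ) := by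
  have h := ((summable_jacobiTheta₂_term_iff
    ((τ : ℂ) / 2 + (z + Real.pi * Complex.I) / (2 * Real.pi * Complex.I)) τ).2 τ.im_pos).mul_left
    (Complex.exp (Complex.I * Real.pi * τ / 4 + (z + Real.pi * Complex.I) / 2))
  refine h.congr fun m => ?_
  rw [jacobiTheta₂_term, theta1Term, ← Complex.exp_add]
  congr 1
  have hpi : (Real.pi : ℂ) ≠ 0 := Complex.ofReal_ne_zero.2 Real.pi_ne_zero
  have hI := Complex.I_ne_zero
  push_cast
  field_simp
  ring

theorem theta1Term_step (z τ : ℂ) (m : ℤ) :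
    theta1Term z τ m = -Complex.exp (2 * Real.pi * Complex.I * τ) ^ m * Complex.exp z *
      theta1Term z τ (m - 1) := by
  rw [theta1Term, theta1Term, ← Complex.exp_int_mul, neg_mul, neg_mul, ← neg_one_mul,
    ← Complex.exp_pi_mul_I, ← Complex.exp_add, ← Complex.exp_add, ← Complex.exp_add]
  congr 1
  push_cast
  ring

theorem norm_nome_lt_one (τ : ℍ) : ‖Complex.exp (2 * Real.pi * Complex.I * (τ : ℂ))‖ < 1 :=
  UpperHalfPlane.norm_exp_two_pi_I_lt_one τ

theorem norm_nome_mul_exp_lt_one (τ : ℍ) {z : ℂ} (h : z.re < 2 * Real.pi * τ.im) :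
    ‖Complex.exp (2 * Real.pi * Complex.I * (τ : ℂ)) * Complex.exp z‖ < 1 := by
  rw [← Complex.exp_add, Complex.norm_exp, Real.exp_lt_one_iff]
  simp
  linarith

theorem differentiableAt_lambertLog {q x : ℂ} (hq : ‖q‖ < 1) (hq0 : q ≠ 0) (hx : ‖q * x‖ < 1) :
    DifferentiableAt ℂ (lambertLog q) x := by
  have hpos : 0 < ‖q‖ := norm_pos_iff.2 hq0
  obtain ⟨r, hr1, hr2⟩ := exists_between (show ‖x‖ < ‖q‖⁻¹ by
    rw [← one_div, lt_div_iff₀ hpos, mul_comm, ← norm_mul]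
    exact hx)
  have hr0 : 0 ≤ r := (norm_nonneg x).trans hr1.le
  have hr : ‖q * (r : ℂ)‖ < 1 := by
    rw [norm_mul, Complex.norm_real, Real.norm_of_nonneg hr0, mul_comm]
    rwa [← one_div, lt_div_iff₀ hpos] at hr2
  have h := Complex.differentiableOn_tsum_of_summable_norm (hasSum_lambertLog hq hr).summable.norm
    (F := fun (m : ℕ+) (x : ℂ) =>
      q ^ (m : ℕ) / (1 - q ^ (m : ℕ)) * (x ^ (m : ℕ) / ((m : ℕ) : ℂ)))
    (U := Metric.ball 0 r) (fun m => by fun_prop) Metric.isOpen_ball fun m w hw => by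
      rw [norm_mul, norm_mul, norm_div (w ^ _), norm_div ((r : ℂ) ^ _), norm_pow, norm_pow,
        Complex.norm_real, Real.norm_of_nonneg hr0]
      have : ‖w‖ ≤ r := (by simpa using hw : ‖w‖ < r).le
      gcongr
  exact h.differentiableAt (Metric.isOpen_ball.mem_nhds (by simpa using hr1))

/-- The logarithm of `∏_{k > 0} (1 - qᵏ)² / ((1 - qᵏ eᶻ) (1 - qᵏ e⁻ᶻ))`. -/
def lambertPair (q z : ℂ) : ℂ :=
  lambertLog q (Complex.exp z) + lambertLog q (Complex.exp (-z)) - 2 * lambertLog q 1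

theorem lambertPair_zero (q : ℂ) : lambertPair q 0 = 0 := by
  simp [lambertPair]
  ring

section

variable (τ : ℍ) {z : ℂ}

theorem differentiableAt_lambertPair (h1 : z.re < 2 * Real.pi * τ.im)
    (h2 : -z.re < 2 * Real.pi * τ.im) :
    DifferentiableAt ℂ (lambertPair (Complex.exp (2 * Real.pi * Complex.I * (τ : ℂ)))) z := by
  have e1 := differentiableAt_lambertLog (norm_nome_lt_one τ) (Complex.exp_ne_zero _)
    (norm_nome_mul_exp_lt_one τ h1)
  have e2 := differentiableAt_lambertLog (norm_nome_lt_one τ) (Complex.exp_ne_zero _)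
    (norm_nome_mul_exp_lt_one τ (z := -z) (by simpa using h2))
  exact ((e1.comp z Complex.differentiableAt_exp).add
    (e2.comp z (Complex.differentiableAt_exp.comp z differentiableAt_id.neg))).sub_const _

/-- The value of `∂_z ϑ₁(0, τ)`, namely `i q^{1/8} ∏ (1 - qᵏ)³`. -/
def theta1Const : ℂ :=
  Complex.exp (Complex.I * Real.pi * τ / 4 + Real.pi * Complex.I / 2) *
    Complex.exp (-3 * lambertLog (Complex.exp (2 * Real.pi * Complex.I * (τ : ℂ))) 1)

theorem theta1_eq (h1 : z.re < 2 * Real.pi * τ.im) (h2 : -z.re < 2 * Real.pi * τ.im) :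
    theta1 z τ = theta1Const τ * ((Complex.exp (z / 2) - Complex.exp (-z / 2)) *
      Complex.exp (-lambertPair (Complex.exp (2 * Real.pi * Complex.I * (τ : ℂ))) z)) := by
  have h := tsum_eq_triple_product (norm_nome_lt_one τ) (Complex.exp_ne_zero _)
    (Complex.exp_ne_zero z) (norm_nome_mul_exp_lt_one τ h1) (by
      rw [← Complex.exp_neg]
      exact norm_nome_mul_exp_lt_one τ (by simpa using h2))
    (summable_theta1Term z τ) (theta1Term_step z τ)
  have h0 : theta1Term z τ 0 =
      Complex.exp (Complex.I * Real.pi * τ / 4 + Real.pi * Complex.I / 2) *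
        Complex.exp (z / 2) := by
    rw [theta1Term, ← Complex.exp_add]
    congr 1
    push_cast
    ring
  have h3 : Complex.exp (z / 2) * (1 - (Complex.exp z)⁻¹) =
      Complex.exp (z / 2) - Complex.exp (-z / 2) := by
    rw [mul_sub, mul_one, ← Complex.exp_neg, ← Complex.exp_add]
    congr 2
    ring
  have h4 : ∀ u v w : ℂ, Complex.exp (-u) * (Complex.exp (-v) * Complex.exp (-w)) =
      Complex.exp (-3 * u) * Complex.exp (-(v + w - 2 * u)) := by
    intro u v w
    rw [← Complex.exp_add, ← Complex.exp_add, ← Complex.exp_add]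
    congr 1
    ring
  change ∑' m, theta1Term z τ m = _
  rw [h, h0, h4, theta1Const, ← h3, ← Complex.exp_neg, lambertPair]
  ring

theorem hasDerivAt_theta1 : HasDerivAt (fun w => theta1 w τ) (theta1Const τ) 0 := by
  have hσ : 0 < 2 * Real.pi * τ.im := mul_pos Real.two_pi_pos τ.im_pos
  have h1 : HasDerivAt (fun w : ℂ => Complex.exp (w / 2) - Complex.exp (-w / 2)) 1 0 := by
    have e1 := ((hasDerivAt_id (0 : ℂ)).div_const 2).cexp
    have e2 := ((hasDerivAt_id (0 : ℂ)).neg.div_const 2).cexp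
    convert! e1.sub e2 using 1
    simp
    norm_num
  have h2 := (differentiableAt_lambertPair τ (z := 0) (by simpa using hσ)
    (by simpa using hσ)).hasDerivAt.neg.cexp
  have h3 := (h1.mul h2).const_mul (theta1Const τ)
  have h4 : HasDerivAt (fun w => theta1Const τ * ((Complex.exp (w / 2) - Complex.exp (-w / 2)) *
      Complex.exp (-lambertPair (Complex.exp (2 * Real.pi * Complex.I * (τ : ℂ))) w)))
      (theta1Const τ) 0 := by
    convert! h3 using 1
    simp [lambertPair_zero]
  refine h4.congr_of_eventuallyEq ?_
  have hc : Filter.Tendsto (fun w : ℂ => w.re) (𝓝 0) (𝓝 0) := by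
    simpa using Complex.continuous_re.tendsto 0
  have hc' : Filter.Tendsto (fun w : ℂ => -w.re) (𝓝 0) (𝓝 0) := by simpa using hc.neg
  filter_upwards [hc.eventually (gt_mem_nhds hσ), hc'.eventually (gt_mem_nhds hσ)] with w h5 h6
  exact theta1_eq τ h5 h6

theorem primeForm_eq (h1 : z.re < 2 * Real.pi * τ.im) (h2 : -z.re < 2 * Real.pi * τ.im) :
    primeForm z τ = (Complex.exp (z / 2) - Complex.exp (-z / 2)) *
      Complex.exp (-lambertPair (Complex.exp (2 * Real.pi * Complex.I * (τ : ℂ))) z) := by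
  have h0 : theta1Const τ ≠ 0 := mul_ne_zero (Complex.exp_ne_zero _) (Complex.exp_ne_zero _)
  rw [primeForm, (hasDerivAt_theta1 τ).deriv, theta1_eq τ h1 h2, mul_div_cancel_left₀ _ h0]

end

theorem one_sub_exp_neg_re_pos {z : ℂ} (hz : 0 < z.re) : 0 < (1 - Complex.exp (-z)).re := by
  have h1 : ‖Complex.exp (-z)‖ < 1 := by
    rw [Complex.norm_exp, Real.exp_lt_one_iff]
    simpa using hz
  have h2 := (Complex.re_le_norm (Complex.exp (-z))).trans_lt h1
  simpa using h2

/-- In the right half plane both arguments lie in `(-π/2, π/2)`, so that the difference of the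
principal logarithms is the principal logarithm of the quotient. -/
theorem tendsto_log_one_sub_exp_neg_sub_log {s : Set ℂ} (hs : ∀ z ∈ s, 0 < z.re) :
    Filter.Tendsto (fun z => Complex.log (1 - Complex.exp (-z)) - Complex.log z)
      (𝓝[s] 0) (𝓝 0) := by
  have hder : HasDerivAt (fun z : ℂ => 1 - Complex.exp (-z)) 1 0 := by
    simpa using (hasDerivAt_id (0 : ℂ)).neg.cexp.const_sub 1
  have hslope : Filter.Tendsto (fun z : ℂ => (1 - Complex.exp (-z)) / z) (𝓝[s] 0) (𝓝 1) := by
    have h := hder.tendsto_slope_zero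
    simp only [zero_add, neg_zero, Complex.exp_zero, sub_self, sub_zero, smul_eq_mul] at h
    have hsub : s ⊆ {0}ᶜ := fun z hz h0 => by
      have := hs z hz
      rw [Set.mem_singleton_iff.1 h0] at this
      simp at this
    refine (h.mono_left (nhdsWithin_mono _ hsub)).congr fun z => ?_
    rw [div_eq_inv_mul]
  have hlog := (continuousAt_clog (x := 1) (by simp)).tendsto.comp hslope
  rw [Complex.log_one] at hlog
  refine hlog.congr' ?_
  filter_upwards [self_mem_nhdsWithin] with z hz
  have hz0 : 0 < z.re := hs z hz
  have hw0 := one_sub_exp_neg_re_pos hz0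
  have hzne : z ≠ 0 := fun h => by simp [h] at hz0
  have hwne : 1 - Complex.exp (-z) ≠ 0 := fun h => by simp [h] at hw0
  have a1 := abs_lt.1 (Complex.abs_arg_lt_pi_div_two_iff.2 (Or.inl hz0))
  have a2 := abs_lt.1 (Complex.abs_arg_lt_pi_div_two_iff.2 (Or.inl hw0))
  rw [Function.comp_apply, ← Complex.log_exp (x := Complex.log (1 - Complex.exp (-z)) -
    Complex.log z), Complex.exp_sub, Complex.exp_log hzne, Complex.exp_log hwne]
  · rw [Complex.sub_im, Complex.log_im, Complex.log_im]
    linarith [a1.2, a2.1]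
  · rw [Complex.sub_im, Complex.log_im, Complex.log_im]
    linarith [a1.1, a2.2]

/-- The holomorphic logarithm of the prime form on the strip, read off from the product formula. -/
def logPrimeForm (τ : ℍ) (z : ℂ) : ℂ :=
  z / 2 + Complex.log (1 - Complex.exp (-z)) -
    lambertPair (Complex.exp (2 * Real.pi * Complex.I * (τ : ℂ))) z

theorem isLogPrimeForm_logPrimeForm (τ : ℍ) : IsLogPrimeForm τ (logPrimeForm τ) where
  holo := fun z hz => by
    have h1 : -z.re < 2 * Real.pi * τ.im := by linarith [hz.1, hz.2]
    have h2 : DifferentiableAt ℂ (fun z => Complex.log (1 - Complex.exp (-z))) z :=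
      DifferentiableAt.clog (by fun_prop) (Or.inl (one_sub_exp_neg_re_pos hz.1))
    exact (((differentiableAt_id.div_const 2).add h2).sub
      (differentiableAt_lambertPair τ hz.2 h1)).differentiableWithinAt
  exp_eq := fun z hz => by
    have h1 : -z.re < 2 * Real.pi * τ.im := by linarith [hz.1, hz.2]
    have hw0 := one_sub_exp_neg_re_pos hz.1
    have hwne : 1 - Complex.exp (-z) ≠ 0 := fun h => by simp [h] at hw0
    rw [logPrimeForm, primeForm_eq τ hz.2 h1, sub_eq_add_neg, Complex.exp_add, Complex.exp_add,
      Complex.exp_log hwne, mul_sub, mul_one, ← Complex.exp_add]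
    congr 3
    ring_nf
  tendsto_zero := by
    have hσ : 0 < 2 * Real.pi * τ.im := mul_pos Real.two_pi_pos τ.im_pos
    have h1 := tendsto_log_one_sub_exp_neg_sub_log (s := strip τ) fun z hz => hz.1
    have h2 := ((differentiableAt_lambertPair τ (z := 0) (by simpa using hσ)
      (by simpa using hσ)).continuousAt.tendsto).mono_left (nhdsWithin_le_nhds (s := strip τ))
    have h3 : Filter.Tendsto (fun z : ℂ => z / 2) (𝓝[strip τ] 0) (𝓝 (0 / 2)) :=
      (Filter.tendsto_id.div_const 2).mono_left nhdsWithin_le_nhds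
    have h4 := (h3.add h1).sub h2
    rw [lambertPair_zero, zero_div, add_zero, sub_zero] at h4
    refine h4.congr fun z => ?_
    rw [logPrimeForm]
    ring

/-! ### Evaluation of the `n`-point function -/

theorem sum_sum_eq_sum_lt {n : ℕ} (c : Fin n → Fin n → ℂ) :
    ∑ i, ∑ j, c i j =
      (∑ p : Fin n × Fin n with p.1 < p.2, (c p.1 p.2 + c p.2 p.1)) + ∑ i, c i i := by
  have h : ∀ i j, c i j = (if i < j then c i j else 0) + (if j < i then c i j else 0) +
      if i = j then c i j else 0 := by
    intro i j
    rcases lt_trichotomy i j with h | h | h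
    · simp [h, h.not_gt, h.ne]
    · simp [h]
    · simp [h, h.not_gt, h.ne']
  have h' : ∑ i, ∑ j, (if j < i then c i j else 0) = ∑ i, ∑ j, if i < j then c j i else 0 :=
    Finset.sum_comm
  rw [Finset.sum_congr rfl fun i _ => Finset.sum_congr rfl fun j _ => h i j]
  simp only [Finset.sum_add_distrib, h', Finset.sum_filter, Fintype.sum_prod_type,
    Finset.sum_ite_eq, Finset.mem_univ, if_true]

/-- Charge neutrality symmetrizes the powers of the `qᵢ = exp zᵢ` that do not come from the
oscillators. -/
theorem sum_zero_mode {n : ℕ} {β : Fin n → ℂ} (hβ : ∑ i, β i = 0) (z : Fin n → ℂ) :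
    ∑ i, (β i ^ 2 / 2 * z i + β i * (∑ j with i < j, β j) * z i) =
      ∑ p : Fin n × Fin n with p.1 < p.2, β p.1 * β p.2 * ((z p.1 - z p.2) / 2) := by
  have h1 := sum_sum_eq_sum_lt fun i j => β i * z i * β j
  simp only [← Finset.mul_sum, hβ, mul_zero, Finset.sum_const_zero] at h1
  have h2 : ∑ i, β i * (∑ j with i < j, β j) * z i =
      ∑ p : Fin n × Fin n with p.1 < p.2, β p.1 * β p.2 * z p.1 := by
    rw [Finset.sum_filter, Fintype.sum_prod_type]
    refine Finset.sum_congr rfl fun i _ => ?_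
    rw [Finset.mul_sum, Finset.sum_mul, Finset.sum_filter]
  have h3 : ∑ i, β i ^ 2 / 2 * z i = (∑ i, β i * z i * β i) / 2 := by
    rw [Finset.sum_div]
    exact Finset.sum_congr rfl fun i _ => by ring
  have h4 : ∑ p : Fin n × Fin n with p.1 < p.2, β p.1 * β p.2 * ((z p.1 - z p.2) / 2) =
      (∑ p : Fin n × Fin n with p.1 < p.2, β p.1 * β p.2 * z p.1) -
        (∑ p : Fin n × Fin n with p.1 < p.2,
          (β p.1 * z p.1 * β p.2 + β p.2 * z p.2 * β p.1)) / 2 := by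
    rw [Finset.sum_div, ← Finset.sum_sub_distrib]
    exact Finset.sum_congr rfl fun p _ => by ring
  rw [Finset.sum_add_distrib, h2, h3, h4]
  linear_combination -(1 / 2 : ℂ) * h1

/-- The eta function in the exponential form `q^{1/24} exp (-lambertLog q 1)`. -/
theorem eta_eq (τ : ℍ) : ModularForm.eta (τ : ℂ) =
    Complex.exp (2 * Real.pi * Complex.I * (τ : ℂ) / 24) *
      Complex.exp (-lambertLog (Complex.exp (2 * Real.pi * Complex.I * (τ : ℂ))) 1) := by
  have hq := norm_nome_lt_one τ
  have h := (Equiv.pnatEquivNat.symm.hasProd_iff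
    (f := fun k : ℕ+ => 1 - Complex.exp (2 * Real.pi * Complex.I * (τ : ℂ)) ^ (k : ℕ) * 1)).2
      (hasProd_one_sub hq (by simpa using hq))
  rw [ModularForm.eta, ← h.tprod_eq]
  congr 1
  refine tprod_congr fun n => ?_
  simp [ModularForm.eta_q_eq_pow, Equiv.pnatEquivNat]

/-- The oscillator part of the trace, in terms of the logarithm of the prime form. -/
theorem oscillator_exponent {n : ℕ} (τ : ℍ) {β : Fin n → ℂ} (hβ : ∑ i, β i = 0)
    (z : Fin n → ℂ) {q : ℂ} (hq : q = Complex.exp (2 * Real.pi * Complex.I * (τ : ℂ))) :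
    (∑ p : Fin n × Fin n with p.1 < p.2, -β p.1 * β p.2 *
        -Complex.log (1 - Complex.exp (z p.2) / Complex.exp (z p.1))) +
      ∑ i, ∑ j, β i * -β j * lambertLog q (Complex.exp (z i) / Complex.exp (z j)) =
    ∑ p : Fin n × Fin n with p.1 < p.2,
      β p.1 * β p.2 * (logPrimeForm τ (z p.1 - z p.2) - (z p.1 - z p.2) / 2) := by
  have h1 := sum_sum_eq_sum_lt fun i j => β i * β j
  simp only [← Finset.mul_sum, hβ, mul_zero, Finset.sum_const_zero] at h1
  rw [sum_sum_eq_sum_lt]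
  have h2 : ∑ i, β i * -β i * lambertLog q (Complex.exp (z i) / Complex.exp (z i)) =
      lambertLog q 1 * ∑ p : Fin n × Fin n with p.1 < p.2, (β p.1 * β p.2 + β p.2 * β p.1) := by
    have h3 : ∑ i, β i * -β i * lambertLog q (Complex.exp (z i) / Complex.exp (z i)) =
        -lambertLog q 1 * ∑ i, β i * β i := by
      rw [Finset.mul_sum]
      refine Finset.sum_congr rfl fun i _ => ?_
      rw [div_self (Complex.exp_ne_zero _)]
      ring
    rw [h3]
    linear_combination lambertLog q 1 * h1
  rw [h2, Finset.mul_sum, ← Finset.sum_add_distrib, ← Finset.sum_add_distrib]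
  refine Finset.sum_congr rfl fun p _ => ?_
  rw [← Complex.exp_sub, ← Complex.exp_sub, logPrimeForm, lambertPair, ← hq, neg_sub]
  ring

/-- The `n`-point function converges absolutely to its closed form. -/
theorem hasSum_nPointTerm (τ : ℍ) {n : ℕ} (α : ℂ) {β z : Fin n → ℂ} (hβ : ∑ i, β i = 0)
    (hz : ∀ r s : Fin n, r < s → z r - z s ∈ strip τ) :
    HasSum (nPointTerm τ α β z)
      (Complex.exp (2 * Real.pi * Complex.I * (τ : ℂ) * (α ^ 2 / 2)) / ModularForm.eta (τ : ℂ) *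
        Complex.exp (α * ∑ i, β i * z i) *
        ∏ p : Fin n × Fin n with p.1 < p.2,
          Complex.exp (β p.1 * β p.2 * logPrimeForm τ (z p.1 - z p.2))) := by
  have hσ : 0 < 2 * Real.pi * τ.im := mul_pos Real.two_pi_pos τ.im_pos
  have h1 : ∀ i j, i < j → ‖Complex.exp (z j) / Complex.exp (z i)‖ < 1 := by
    intro i j hij
    rw [← Complex.exp_sub, Complex.norm_exp, Real.exp_lt_one_iff]
    have := (hz i j hij).1
    rw [Complex.sub_re] at this ⊢
    linarith
  have h2 : ∀ i j, ‖Complex.exp (2 * Real.pi * Complex.I * (τ : ℂ)) *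
      (Complex.exp (z i) / Complex.exp (z j))‖ < 1 := by
    intro i j
    rw [← Complex.exp_sub]
    refine norm_nome_mul_exp_lt_one τ ?_
    rcases lt_trichotomy i j with h | rfl | h
    · exact (hz i j h).2
    · simpa using hσ
    · have := (hz j i h).1
      rw [Complex.sub_re] at this ⊢
      linarith
  have hT := hasSum_traceTerm (norm_nome_lt_one τ) β (fun i => Complex.exp_ne_zero (z i)) h1 h2
  have hsum := (hT.tsum_fiberwise fun t : (ℕ+ →₀ ℕ) × (Fin n → (ℕ+ →₀ ℕ) × (ℕ+ →₀ ℕ)) =>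
    (Finsupp.weight wt t.1, exponents α β fun i => degShift (t.2 i))).mul_left
      ((∏ i, Complex.exp (β i ^ 2 / 2 * z i) * Complex.exp (exponents α β 0 i * z i)) *
        Complex.exp (2 * Real.pi * Complex.I * (τ : ℂ) * (α ^ 2 / 2 - 1 / 24)))
  have hterm := nPointTerm_eq_tsum τ α hβ z hT.summable
  have h3 : ∑ i, (β i ^ 2 / 2 * z i + exponents α β 0 i * z i) =
      α * ∑ i, β i * z i +
        ∑ i, (β i ^ 2 / 2 * z i + β i * (∑ j with i < j, β j) * z i) := by
    rw [Finset.mul_sum, ← Finset.sum_add_distrib]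
    refine Finset.sum_congr rfl fun i _ => ?_
    simp only [exponents, Pi.zero_apply, Int.cast_zero]
    ring
  have h4 : ∑ p : Fin n × Fin n with p.1 < p.2,
      β p.1 * β p.2 * (logPrimeForm τ (z p.1 - z p.2) - (z p.1 - z p.2) / 2) =
      (∑ p : Fin n × Fin n with p.1 < p.2, β p.1 * β p.2 * logPrimeForm τ (z p.1 - z p.2)) -
        ∑ p : Fin n × Fin n with p.1 < p.2, β p.1 * β p.2 * ((z p.1 - z p.2) / 2) := by
    rw [← Finset.sum_sub_distrib]
    exact Finset.sum_congr rfl fun p _ => by ring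
  rw [funext hterm]
  refine Eq.subst (motive := fun a => HasSum _ a) ?_ hsum
  symm
  rw [oscillator_exponent τ hβ z rfl, eta_eq, h4, ← Complex.exp_add, ← Complex.exp_add,
    ← Complex.exp_sub, ← Complex.exp_sum, ← Complex.exp_add, ← Complex.exp_add]
  simp only [← Complex.exp_add, ← Complex.exp_sum]
  congr 1
  rw [h3, sum_zero_mode hβ]
  ring

end HeisenbergTorus

end

theorem proposition3 (τ : ℍ) :
    ∃ ℓ : ℂ → ℂ, HeisenbergTorus.IsLogPrimeForm τ ℓ ∧
      ∀ (n : ℕ) (α : ℂ) (β z : Fin n → ℂ), ∑ i, β i = 0 →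
        (∀ r s : Fin n, r < s → z r - z s ∈ HeisenbergTorus.strip τ) →
        Summable (HeisenbergTorus.nPointTerm τ α β z) ∧
        HeisenbergTorus.nPoint τ α β z =
          Complex.exp (2 * Real.pi * Complex.I * (τ : ℂ) * (α ^ 2 / 2)) / ModularForm.eta (τ : ℂ) *
            Complex.exp (α * ∑ i, β i * z i) *
            ∏ p : Fin n × Fin n with p.1 < p.2,
              Complex.exp (β p.1 * β p.2 * ℓ (z p.1 - z p.2)) := by
  refine ⟨HeisenbergTorus.logPrimeForm τ, HeisenbergTorus.isLogPrimeForm_logPrimeForm τ,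
    fun n α β z hβ hz => ?_⟩
  have h := HeisenbergTorus.hasSum_nPointTerm τ α hβ hz
  exact ⟨h.summable, h.tsum_eq⟩
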